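/- Let $d\ge 2$, let $0<\sigma<1$, and let $\Gamma=\partial\Omega$ be the boundary of a bounded Lipschitz domain $\Omega\subset\mathbb R^d$ (not necessarily connected). Write $|\cdot|$ for the $(d-1)$-dimensional surface (Hausdorff) measure. For measurable $\omega\subseteq\Gamma$ and scalar $u$ put $$|u|_{H^\sigma(\omega)}^2=\int_\omega\int_\omega\frac{|u(x)-u(y)|^2}{|x-y|^{d-1+2\sigma}}\,dx\,dy,\qquad \|u\|_{H^\sigma(\omega)}^2=\|u\|_{L^2(\omega)}^2+|u|_{H^\sigma(\omega)}^2,$$ let $H^\sigma(\Gamma)$ be the space of all $u\in L^2(\Gamma)$ (complex-valued) with $\|u\|_{H^\sigma(\Gamma)}<\infty$, and for vector-valued $v=(v_1,\dots,v_D)$ put $|v|_{H^\sigma(\omega)}^2=\sum_j|v_j|_{H^\sigma(\omega)}^2$ and $\|v\|_{H^\sigma(\omega)}^2=\sum_j\|v_j\|_{H^\sigma(\omega)}^2$. A mesh of $\Gamma$ is a finite set $\mathcal T$ of bi-Lipschitz images in $\mathbb R^d$ of closures of nonempty bounded Lipschitz domains in $\mathbb R^{d-1}$ such that $\Gamma=\bigcup_{T\in\mathcal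 T}T$ and $|T\cap T'|=0$ for $T\ne T'$ in $\mathcal T$. For $\omega\subseteq\Gamma$ let $\pi^0(\omega)=\omega$, $\pi^q(\omega)=\bigcup\{T\in\mathcal T: T\cap\pi^{q-1}(\omega)\neq\emptyset\}$ for $q\ge1$, $\Pi^q(\omega)=\{T\in\mathcal T: T\subseteq\pi^q(\omega)\}$, $\pi=\pi^1$, $\Pi=\Pi^1$, and let $h_T=|T|^{1/(d-1)}$. Let $C_{\rm patch},C_{\rm locuni},C_{\rm shape},C_{\rm cent}>0$, $q_{\rm supp}\in\mathbb N_0$ and $0<\rho_{\rm unity}<1$. Then there is a constant $C_{\rm split}>0$, depending only on $d$, $\sigma$, $\Gamma$ and these six constants, such that the following holds. Let $\mathcal T$ be a mesh of $\Gamma$ such that for all $T\in\mathcal T$: - (M1) $\#\Pi(T)\le C_{\rm patch}$; - (M2) $\operatorname{diam}(T)/\operatorname{diam}(T')\le C_{\rm locuni}$ for all $T'\in\Pi(T)$; - (M3) $C_{\rm shape}^{-1}\le \operatorname{diam}(T)/h_T\le C_{\rm shape}$; - (M4) $\operatorname{diam}(T)\le C_{\rm cent}\operatorname{dist}(T,\Gamma\setminus\pi(T))$,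 where $\operatorname{dist}(T,\emptyset):=\operatorname{diam}(\Gamma)$. Let $\mathcal X\subset L^2(\Gamma)^D$ be a finite-dimensional subspace, and let $\Psi_{T,j}\in\mathcal X$ ($T\in\mathcal T$, $j=1,\dots,D$) satisfy - (S4) $T\subseteq\operatorname{supp}(\Psi_{T,j})\subseteq\pi^{q_{\rm supp}}(T)$, $(\Psi_{T,j})_{j'}=0$ for $j'\ne j$, and $\|1-(\Psi_{T,j})_j\|_{L^2(\operatorname{supp}\Psi_{T,j})}\le\rho_{\rm unity}\,|\operatorname{supp}(\Psi_{T,j})_j|^{1/2}$, where $\operatorname{supp}$ denotes the support of an $L^2$-function, i.e. the set of points with no open neighbourhood on which the function vanishes almost everywhere. Then every $v\in H^\sigma(\Gamma)^D$ with $\langle v,\Psi_{T,j}\rangle_{L^2(\Gamma)^D}=\langle v_j,(\Psi_{T,j})_j\rangle_{L^2(\Gamma)}=0$ for all $T\in\mathcal T$ and $j\in\{1,\dots,D\}$ satisfies $$\|v\|_{H^\sigma(\Gamma)}^2\le C_{\rm split}\sum_{T\in\mathcal T}\sum_{T'\in\Pi(T)}|v|_{H^\sigma(T\cup T')}^2 .$$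 -/

import Mathlib

open MeasureTheory Topology
open scoped ENNReal NNReal MeasureTheory

noncomputable section

namespace BEM

/-- The Euclidean space `ℝⁿ`. -/
abbrev Euc (n : ℕ) : Type := EuclideanSpace ℝ (Fin n)

/-- `U` is, up to a rigid motion of `ℝⁿ = ℝⁿ⁻¹ × ℝ`, a Lipschitz hypograph
`{(x', t) | t < ζ x'}` with a Lipschitz function `ζ : ℝⁿ⁻¹ → ℝ`. -/
def IsLipschitzHypograph {n : ℕ} (U : Set (Euc n)) : Prop :=
  ∃ (φ : Euc n ≃ᵢ WithLp 2 (Euc (n - 1) × ℝ)) (ζ : Euc (n - 1) → ℝ) (K : ℝ≥0),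
    LipschitzWith K ζ ∧ U = {x | (φ x).snd < ζ (φ x).fst}

/-- Lipschitz domains: open sets with compact boundary which, in each set of a finite open
cover of the boundary, coincide with a (rigidly moved) Lipschitz hypograph.
As usual in this definition, connectedness is not required. -/
structure IsLipschitzDomain {n : ℕ} (Ω : Set (Euc n)) : Prop where
  isOpen : IsOpen Ω
  isCompact_frontier : IsCompact (frontier Ω)
  exists_cover : ∃ (m : ℕ) (W U : Fin m → Set (Euc n)),
    (∀ i, IsOpen (W i)) ∧ frontier Ω ⊆ ⋃ i, W i ∧
    (∀ i, IsLipschitzHypograph (U i)) ∧ ∀ i, W i ∩ Ω = W i ∩ U i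

/-- Compact Lipschitz domains: closures of (nonempty) bounded Lipschitz domains. -/
def IsCompactLipschitzDomain {n : ℕ} (S : Set (Euc n)) : Prop :=
  ∃ U : Set (Euc n), IsLipschitzDomain U ∧ Bornology.IsBounded U ∧ U.Nonempty ∧ S = closure U

/-- `γ` restricts to a bi-Lipschitz bijection from `S` onto `T`. -/
def IsBiLipschitzOnto {m n : ℕ} (γ : Euc m → Euc n) (S : Set (Euc m)) (T : Set (Euc n)) : Prop :=
  γ '' S = T ∧ ∃ L : ℝ, 0 < L ∧ ∀ s ∈ S, ∀ t ∈ S,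
    L⁻¹ * dist s t ≤ dist (γ s) (γ t) ∧ dist (γ s) (γ t) ≤ L * dist s t

/-- The `(d-1)`-dimensional surface measure on `Γ ⊆ ℝᵈ`: Hausdorff measure, normalized so that
it is Lebesgue measure on `ℝᵈ⁻¹`. -/
def surfaceMeasure {d : ℕ} (Γ : Set (Euc d)) : Measure (Euc d) :=
  (μHE[d - 1] : Measure (Euc d)).restrict Γ

/-- Meshes of `Γ`. -/
structure IsMesh {d : ℕ} (Γ : Set (Euc d)) (𝒯 : Finset (Set (Euc d))) : Prop where
  element : ∀ T ∈ 𝒯, ∃ (S : Set (Euc (d - 1))) (γ : Euc (d - 1) → Euc d),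
    IsCompactLipschitzDomain S ∧ IsBiLipschitzOnto γ S T
  cover : Γ = ⋃ T ∈ 𝒯, T
  overlap : ∀ T ∈ 𝒯, ∀ T' ∈ 𝒯, T ≠ T' → (μHE[d - 1] : Measure (Euc d)) (T ∩ T') = 0

/-- The patch `π^q(ω)` of order `q`. -/
def patch {d : ℕ} (𝒯 : Finset (Set (Euc d))) : ℕ → Set (Euc d) → Set (Euc d)
  | 0, ω => ω
  | q + 1, ω => ⋃₀ {T | T ∈ 𝒯 ∧ (T ∩ patch 𝒯 q ω).Nonempty}

open Classical in
/-- The set of elements `Π^q(ω)` of the patch of order `q`. -/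
def patchElements {d : ℕ} (𝒯 : Finset (Set (Euc d))) (q : ℕ) (ω : Set (Euc d)) :
    Finset (Set (Euc d)) :=
  𝒯.filter fun T => T ⊆ patch 𝒯 q ω

/-- The local mesh width `h_T = |T|^{1/(d-1)}`. -/
def meshWidth {d : ℕ} (T : Set (Euc d)) : ℝ :=
  ((μHE[d - 1] : Measure (Euc d)).real T) ^ (1 / ((d : ℝ) - 1))

open Classical in
/-- The distance of `T` to `B ⊆ Γ`, with the convention `dist(T, ∅) = diam Γ`. -/
def setDist {d : ℕ} (Γ T B : Set (Euc d)) : ℝ :=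
  if B.Nonempty then sInf (Set.image2 dist T B) else Metric.diam Γ

/-- Bounded element patch. -/
def BoundedPatch {d : ℕ} (𝒯 : Finset (Set (Euc d))) (Cpatch : ℝ) : Prop :=
  ∀ T ∈ 𝒯, ((patchElements 𝒯 1 T).card : ℝ) ≤ Cpatch

/-- Local quasi-uniformity. -/
def LocallyQuasiUniform {d : ℕ} (𝒯 : Finset (Set (Euc d))) (Clocuni : ℝ) : Prop :=
  ∀ T ∈ 𝒯, ∀ T' ∈ patchElements 𝒯 1 T, Metric.diam T / Metric.diam T' ≤ Clocuni

/-- Shape-regularity. -/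
def ShapeRegular {d : ℕ} (𝒯 : Finset (Set (Euc d))) (Cshape : ℝ) : Prop :=
  ∀ T ∈ 𝒯, Cshape⁻¹ ≤ Metric.diam T / meshWidth T ∧ Metric.diam T / meshWidth T ≤ Cshape

/-- Elements lie in the center of their patches. -/
def CenteredInPatch {d : ℕ} (Γ : Set (Euc d)) (𝒯 : Finset (Set (Euc d))) (Ccent : ℝ) : Prop :=
  ∀ T ∈ 𝒯, Metric.diam T ≤ Ccent * setDist Γ T (Γ \ patch 𝒯 1 T)

/-- The space `L²(Γ)^D` of complex vector-valued functions. -/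
abbrev L2 {d : ℕ} (Γ : Set (Euc d)) (D : ℕ) : Type :=
  Lp (EuclideanSpace ℂ (Fin D)) 2 (surfaceMeasure Γ)

/-- The support of an (equivalence class of a) function on `Γ`: the points that have no
open neighbourhood on which the function vanishes almost everywhere. -/
def essSupport {d : ℕ} (Γ : Set (Euc d)) {F : Type*} [Zero F] (f : Euc d → F) : Set (Euc d) :=
  {x | ∀ U : Set (Euc d), IsOpen U → x ∈ U → ¬ f =ᵐ[(surfaceMeasure Γ).restrict U] 0}

/-- Componentwise local approximation of unity: `Ψ T j` are functions in the ansatz space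
`X` with the required properties, with constants `q = q_supp` and `ρ = ρ_unity`. -/
structure IsLocalUnity {d D : ℕ} (Γ : Set (Euc d)) (𝒯 : Finset (Set (Euc d)))
    (X : Submodule ℂ (L2 Γ D)) (q : ℕ) (ρ : ℝ) (Ψ : Set (Euc d) → Fin D → L2 Γ D) : Prop where
  mem : ∀ T ∈ 𝒯, ∀ j, Ψ T j ∈ X
  subset_support : ∀ T ∈ 𝒯, ∀ j, T ⊆ essSupport Γ (Ψ T j)
  support_subset : ∀ T ∈ 𝒯, ∀ j, essSupport Γ (Ψ T j) ⊆ patch 𝒯 q T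
  component_eq_zero : ∀ T ∈ 𝒯, ∀ j j', j' ≠ j → (fun x => Ψ T j x j') =ᵐ[surfaceMeasure Γ] 0
  approx_one : ∀ T ∈ 𝒯, ∀ j,
    eLpNorm (fun x => 1 - Ψ T j x j) 2 ((surfaceMeasure Γ).restrict (essSupport Γ (Ψ T j)))
      ≤ ENNReal.ofReal ρ *
        surfaceMeasure Γ (essSupport Γ fun x => Ψ T j x j) ^ (1 / 2 : ℝ)

/-- The squared Sobolev-Slobodeckij seminorm `|u|²_{H^σ(ω)}` of a scalar function, `0 < σ < 1`. -/
def seminormSq {d : ℕ} (σ : ℝ) (ω : Set (Euc d)) (u : Euc d → ℂ) : ℝ≥0∞ :=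
  ∫⁻ y in ω, ∫⁻ x in ω,
    ENNReal.ofReal (‖u x - u y‖ ^ 2 / dist x y ^ ((d : ℝ) - 1 + 2 * σ)) ∂μHE[d - 1] ∂μHE[d - 1]

/-- The squared Sobolev-Slobodeckij norm `‖u‖²_{H^σ(ω)}` of a scalar function. -/
def normSq {d : ℕ} (σ : ℝ) (ω : Set (Euc d)) (u : Euc d → ℂ) : ℝ≥0∞ :=
  eLpNorm u 2 ((μHE[d - 1] : Measure (Euc d)).restrict ω) ^ 2 + seminormSq σ ω u

/-- The squared seminorm of a vector-valued function: the sum over its components. -/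
def vecSeminormSq {d D : ℕ} (σ : ℝ) (ω : Set (Euc d)) (v : Euc d → EuclideanSpace ℂ (Fin D)) :
    ℝ≥0∞ :=
  ∑ j, seminormSq σ ω fun x => v x j

/-- The squared norm of a vector-valued function: the sum over its components. -/
def vecNormSq {d D : ℕ} (σ : ℝ) (ω : Set (Euc d)) (v : Euc d → EuclideanSpace ℂ (Fin D)) :
    ℝ≥0∞ :=
  ∑ j, normSq σ ω fun x => v x j

/-- `v ∈ L²(Γ)^D` belongs to `H^σ(Γ)^D`: each component has a finite Sobolev-Slobodeckij norm. -/
def MemSobolev {d D : ℕ} (Γ : Set (Euc d)) (σ : ℝ) (v : L2 Γ D) : Prop :=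
  ∀ j, normSq σ Γ (fun x => v x j) < ∞

end BEM

end

open BEM

/-!
Write `n = d - 1`, `s = n + 2σ`, and let `u` be a component of `v`. The kernel of the seminorm is
controlled pairwise: on `T ∪ T'` of diameter at most `R`,
`∫_T ∫_{T'} |u x - u y|² ≤ R ^ s |u|²_{H^σ(T ∪ T')}`
(`lintegral_lintegral_enorm_sub_sq_le`). The argument consists of three estimates.

* *Localization* (`exists_seminormSq_le`). The double integral over `Γ × Γ` is split into pairs of
  elements that touch, which are part of the right-hand side, and pairs that do not. For the
  latter, `|u x - u y|² ≤ 2 |u x|² + 2 |u y|²`, and since elements are centred in their patches, the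
  kernel is integrated over distances `≳ diam T` only. As `Γ` is locally a Lipschitz graph, balls of
  radius `r` have surface measure `≲ r ^ n`
  (`IsLipschitzDomain.measure_frontier_inter_closedBall_le`), so that a dyadic decomposition
  (`lintegral_dist_rpow_neg_le`) bounds this part by `∑_T diam(T)^{-2σ} ‖u‖²_{L²(T)}`.
* *Poincaré inequality for orthogonal functions* (`IsLocalUnity.lintegral_enorm_sq_le`). If `u` is
  orthogonal to `ψ` with `‖1 - ψ‖ ≤ ρ ‖1‖` in `L²(S)`, where `S = supp ψ` and `ρ < 1`, then
  `‖u‖_{L²(S)} ≤ (1 + ρ) / (1 - ρ) ‖u - c‖_{L²(S)}` for every constant `c`. This is a fact on Hilbert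
  spaces (`norm_le_of_inner_eq_zero`).
* *Oscillation on patches* (`RegularMesh.exists_patch_bound`). For a suitable value `c` of `u` on `T`,
  the norm of `u - c` on `T` is bounded by the seminorm on `T` (`RegularMesh.exists_const_bound`).
  For touching elements `T`, `T'`, the scaled norm of `u - c` on `T'` is bounded by the one on `T`
  and the seminorm on `T ∪ T'` (`RegularMesh.exists_neighbour_bound`). An induction on the order of the
  patch gives the estimate on the patch, hence on `S`, and the bounded number of neighbours allows
  to sum over all elements (`RegularMesh.sum_chainSeminormSq_le`).

The last two estimates bound the scaled norms `∑_T diam(T)^{-2σ} ‖u‖²_{L²(T)}`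
(`exists_sum_scaleWeight_mul_lintegral_le`) and thereby both the remainder in the localization and
the `L²`-norm on `Γ`.
-/

open MeasureTheory Topology
open scoped ENNReal NNReal MeasureTheory

namespace BEM

/-! ### Surface measure of balls and the tail of the kernel -/

theorem frontier_inter_eq_of_isOpen {X : Type*} [TopologicalSpace X] {W A B : Set X}
    (hW : IsOpen W) (h : W ∩ A = W ∩ B) : W ∩ frontier A = W ∩ frontier B := by
  have key := fun C : Set X => frontier_inter_open_inter (s := C) hW
  rw [Set.inter_comm W, Set.inter_comm W, ← key A, ← key B, Set.inter_comm A, h, Set.inter_comm W]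

/-- The boundary of a Lipschitz hypograph is parametrized by the Lipschitz map `g`, with Lipschitz
inverse `p`, the projection to the base. -/
theorem frontier_subset_of_isLipschitzHypograph {n : ℕ} {U : Set (Euc n)}
    (hU : IsLipschitzHypograph U) :
    ∃ (p : Euc n → Euc (n - 1)) (g : Euc (n - 1) → Euc n) (K : ℝ≥0),
      LipschitzWith 1 p ∧ LipschitzWith K g ∧ ∀ x ∈ frontier U, g (p x) = x := by
  obtain ⟨φ, ζ, K, hζ, rfl⟩ := hU
  have hφ := φ.isometry
  have h1 : LipschitzWith 1 (fun x => (φ x).fst) := by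
    have := LipschitzWith.prod_fst.comp
      ((WithLp.prod_lipschitzWith_ofLp 2 (Euc (n - 1)) ℝ).comp hφ.lipschitz)
    rw [one_mul, mul_one] at this
    exact this
  have h2 := φ.symm.isometry.lipschitz.comp
    ((WithLp.prod_lipschitzWith_toLp 2 (Euc (n - 1)) ℝ).comp
      (LipschitzWith.id.prodMk hζ))
  refine ⟨fun x => (φ x).fst, _, _, h1, h2, fun x hx => ?_⟩
  have hc1 : Continuous fun x => (φ x).snd := by
    have := φ.continuous
    fun_prop
  have hc2 : Continuous fun x => ζ (φ x).fst := hζ.continuous.comp h1.continuous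
  have := frontier_lt_subset_eq hc1 hc2 hx
  rw [Set.mem_ofPred_eq] at this
  apply φ.injective
  simp only [Function.comp, id, IsometryEquiv.apply_symm_apply]
  rw [← this]
  rfl

theorem euclideanHausdorffMeasure_image_le {n k : ℕ} {K : ℝ≥0} {g : Euc k → Euc n}
    (hg : LipschitzWith K g) (A : Set (Euc k)) :
    (μHE[k] : Measure (Euc n)) (g '' A) ≤ (K : ℝ≥0∞) ^ k * (μHE[k] : Measure (Euc k)) A := by
  simp only [Measure.euclideanHausdorffMeasure_def, Measure.smul_apply]
  have := hg.hausdorffMeasure_image_le (d := k) (by positivity) A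
  rw [ENNReal.rpow_natCast] at this
  calc _ ≤ _ := smul_le_smul_of_nonneg_left this (by positivity)
    _ = _ := by rw [ENNReal.smul_def, ENNReal.smul_def, smul_eq_mul, smul_eq_mul]; ring

/-- Upper Ahlfors regularity of the boundary of a Lipschitz domain: near each boundary point, the
boundary is a Lipschitz image of `ℝᵈ⁻¹`, and the part in a ball is the image of a ball. -/
theorem IsLipschitzDomain.measure_frontier_inter_closedBall_le {d : ℕ}
    {Ω : Set (Euc d)} (hΩ : IsLipschitzDomain Ω) :
    ∃ A : ℝ≥0, ∀ (x : Euc d) (r : ℝ), 0 ≤ r →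
      (μHE[d - 1] : Measure (Euc d)) (frontier Ω ∩ Metric.closedBall x r)
        ≤ A * ENNReal.ofReal (r ^ (d - 1)) := by
  obtain ⟨m, W, U, hW, hcov, hU, hWU⟩ := hΩ.exists_cover
  choose p g K hp hg hgp using fun i => frontier_subset_of_isLipschitzHypograph (hU i)
  let ν : Measure (Euc (d - 1)) := μHE[d - 1]
  have hν : ν.IsAddHaarMeasure := by
    have := isAddHaarMeasure_euclideanHausdorffMeasure (E := Euc (d - 1))
    rwa [finrank_euclideanSpace_fin] at this
  have hfin : ν (Metric.closedBall 0 1) ≠ ∞ := measure_closedBall_lt_top.ne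
  refine ⟨∑ i, K i ^ (d - 1) * (ν (Metric.closedBall 0 1)).toNNReal, fun x r hr => ?_⟩
  have hsub : frontier Ω ∩ Metric.closedBall x r ⊆
      ⋃ i, g i '' Metric.closedBall (p i x) r := by
    rintro y ⟨hy, hyr⟩
    obtain ⟨i, hi⟩ := Set.mem_iUnion.1 (hcov hy)
    have hyU : y ∈ frontier (U i) :=
      ((frontier_inter_eq_of_isOpen (hW i) (hWU i)).subset ⟨hi, hy⟩).2
    refine Set.mem_iUnion.2 ⟨i, p i y, ?_, hgp i y hyU⟩
    rw [Metric.mem_closedBall] at hyr ⊢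
    simpa using ((hp i).dist_le_mul y x).trans (by simpa using hyr)
  calc _ ≤ (μHE[d - 1] : Measure (Euc d)) (⋃ i, g i '' Metric.closedBall (p i x) r) :=
        measure_mono hsub
    _ ≤ ∑ i, (μHE[d - 1] : Measure (Euc d)) (g i '' Metric.closedBall (p i x) r) :=
        measure_iUnion_fintype_le _ _
    _ ≤ ∑ i, (K i : ℝ≥0∞) ^ (d - 1) *
          (ENNReal.ofReal (r ^ (d - 1)) * ν (Metric.closedBall 0 1)) := by
        refine Finset.sum_le_sum fun i _ => ?_
        refine (euclideanHausdorffMeasure_image_le (hg i) _).trans ?_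
        gcongr
        refine (Measure.addHaar_closedBall' ν (p i x) hr).le.trans ?_
        rw [finrank_euclideanSpace_fin]
    _ = _ := by
        push_cast
        rw [Finset.sum_mul, ENNReal.coe_toNNReal hfin]
        exact Finset.sum_congr rfl fun i _ => by ring

/-- The integral of the singular kernel away from its pole scales like the power of the distance
to the pole that upper Ahlfors regularity suggests. -/
theorem lintegral_dist_rpow_neg_le {X : Type*} [PseudoMetricSpace X] [MeasurableSpace X]
    [OpensMeasurableSpace X] {μ : Measure X} {n : ℕ} {A : ℝ≥0}
    (hμ : ∀ (x : X) (r : ℝ), 0 ≤ r → μ (Metric.closedBall x r) ≤ A * ENNReal.ofReal (r ^ n))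
    {a : ℝ} (ha : 0 < a) :
    ∃ C : ℝ≥0, ∀ (x : X) (δ : ℝ), 0 < δ →
      ∫⁻ y in {y | δ ≤ dist x y}, ENNReal.ofReal (dist x y ^ (-(n + a))) ∂μ
        ≤ C * ENNReal.ofReal (δ ^ (-a)) := by
  have hq : ENNReal.ofReal (2 ^ (-a)) < 1 := by
    rw [ENNReal.ofReal_lt_one]
    exact Real.rpow_lt_one_of_one_lt_of_neg (by norm_num) (by linarith)
  have hsum : ∑' k : ℕ, ENNReal.ofReal (2 ^ (-a)) ^ k ≠ ∞ := by
    rw [ENNReal.tsum_geometric]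
    exact ENNReal.inv_ne_top.2 (tsub_pos_of_lt hq).ne'
  refine ⟨A * 2 ^ n * (∑' k : ℕ, ENNReal.ofReal (2 ^ (-a)) ^ k).toNNReal, fun x δ hδ => ?_⟩
  -- Dyadic annuli around `x`.
  let S : ℕ → Set X := fun k => {y | 2 ^ k * δ ≤ dist x y ∧ dist x y ≤ 2 ^ (k + 1) * δ}
  have hcov : {y | δ ≤ dist x y} ⊆ ⋃ k, S k := by
    intro y (hy : δ ≤ dist x y)
    obtain ⟨k, hk1, hk2⟩ := exists_nat_pow_near ((one_le_div hδ).2 hy) one_lt_two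
    exact Set.mem_iUnion.2 ⟨k, (le_div_iff₀ hδ).1 hk1, ((div_lt_iff₀ hδ).1 hk2).le⟩
  have hS : ∀ k, ∫⁻ y in S k, ENNReal.ofReal (dist x y ^ (-(n + a))) ∂μ ≤
      A * 2 ^ n * ENNReal.ofReal (δ ^ (-a)) * ENNReal.ofReal (2 ^ (-a)) ^ k := by
    intro k
    have hr : 0 < 2 ^ k * δ := by positivity
    calc _ ≤ ∫⁻ _ in S k, ENNReal.ofReal ((2 ^ k * δ) ^ (-(n + a))) ∂μ := by
          refine setLIntegral_mono measurable_const fun y hy => ENNReal.ofReal_le_ofReal ?_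
          exact Real.rpow_le_rpow_of_nonpos hr hy.1 (by have : (0 : ℝ) ≤ n := by positivity
                                                        linarith)
      _ = ENNReal.ofReal ((2 ^ k * δ) ^ (-(n + a))) * μ (S k) := by simp
      _ ≤ ENNReal.ofReal ((2 ^ k * δ) ^ (-(n + a))) *
            (A * ENNReal.ofReal ((2 ^ (k + 1) * δ) ^ n)) := by
          gcongr
          refine (measure_mono fun y hy => ?_).trans (hμ x _ (by positivity))
          rw [Metric.mem_closedBall']
          exact hy.2
      _ = A * (ENNReal.ofReal ((2 ^ k * δ) ^ (-(n + a))) *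
            ENNReal.ofReal ((2 ^ (k + 1) * δ) ^ n)) := by ring
      _ = _ := by
          rw [← ENNReal.ofReal_mul (by positivity), ← ENNReal.ofReal_pow (by positivity),
            mul_assoc, mul_assoc]
          congr 1
          have h2 : (2 : ℝ≥0∞) ^ n = ENNReal.ofReal (2 ^ n) := by
            rw [ENNReal.ofReal_pow (by norm_num)]; norm_num
          rw [h2, ← ENNReal.ofReal_mul (by positivity), ← ENNReal.ofReal_mul (by positivity)]
          congr 1
          have e : ((2 : ℝ) ^ k) ^ (-a) = ((2 : ℝ) ^ (-a)) ^ k := by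
            rw [← Real.rpow_natCast, ← Real.rpow_mul (by norm_num), mul_comm,
              Real.rpow_mul_natCast (by norm_num)]
          rw [neg_add, Real.rpow_add hr, Real.rpow_neg hr.le, Real.rpow_natCast,
            Real.mul_rpow (by positivity) hδ.le, pow_succ' (2 : ℝ) k, mul_assoc 2,
            mul_pow 2, e]
          field_simp
  calc _ ≤ ∫⁻ y in ⋃ k, S k, ENNReal.ofReal (dist x y ^ (-(n + a))) ∂μ :=
        lintegral_mono_set hcov
    _ ≤ ∑' k, ∫⁻ y in S k, ENNReal.ofReal (dist x y ^ (-(n + a))) ∂μ := lintegral_iUnion_le _ _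
    _ ≤ ∑' k, A * 2 ^ n * ENNReal.ofReal (δ ^ (-a)) * ENNReal.ofReal (2 ^ (-a)) ^ k :=
        ENNReal.tsum_le_tsum hS
    _ = _ := by
        push_cast
        rw [ENNReal.tsum_mul_left, ENNReal.coe_toNNReal hsum]
        ring

/-! ### Touching elements and regular meshes -/

open Classical in
/-- The elements of `𝒯` that touch `T`. -/
noncomputable def touching {d : ℕ} (𝒯 : Finset (Set (Euc d))) (T : Set (Euc d)) : Finset (Set (Euc d)) :=
  𝒯.filter fun T' => (T' ∩ T).Nonempty

theorem mem_touching {d : ℕ} {𝒯 : Finset (Set (Euc d))} {T T' : Set (Euc d)} :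
    T' ∈ touching 𝒯 T ↔ T' ∈ 𝒯 ∧ (T' ∩ T).Nonempty := by
  simp [touching]

theorem mem_touching_comm {d : ℕ} {𝒯 : Finset (Set (Euc d))} {T T' : Set (Euc d)}
    (hT : T ∈ 𝒯) (h : T' ∈ touching 𝒯 T) : T ∈ touching 𝒯 T' := by
  rw [mem_touching] at h ⊢
  exact ⟨hT, Set.inter_comm T T' ▸ h.2⟩

theorem patch_one {d : ℕ} {𝒯 : Finset (Set (Euc d))} {T : Set (Euc d)} :
    patch 𝒯 1 T = ⋃ T' ∈ touching 𝒯 T, T' := by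
  ext x
  simp [patch, touching]

theorem touching_subset_patchElements {d : ℕ} {𝒯 : Finset (Set (Euc d))} {T : Set (Euc d)} :
    touching 𝒯 T ⊆ patchElements 𝒯 1 T := by
  intro T' h
  simp only [patchElements, Finset.mem_filter]
  refine ⟨(mem_touching.1 h).1, ?_⟩
  rw [patch_one]
  exact Set.subset_biUnion_of_mem (u := fun T => T) h

/-- The definition of the patch adds the outermost layer last; for an induction with varying
centre, the innermost layer is split off instead. -/
theorem patch_succ_subset {d : ℕ} {𝒯 : Finset (Set (Euc d))} {T : Set (Euc d)} (k : ℕ) :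
    patch 𝒯 (k + 1) T ⊆ ⋃ T' ∈ touching 𝒯 T, patch 𝒯 k T' := by
  induction k with
  | zero => exact patch_one.subset
  | succ k ih =>
    rintro x ⟨S, ⟨hS, y, hyS, hy⟩, hx⟩
    obtain ⟨T', hT', hy'⟩ := Set.mem_iUnion₂.1 (ih hy)
    exact Set.mem_iUnion₂.2 ⟨T', hT', S, ⟨hS, y, hyS, hy'⟩, hx⟩

/-- Finite families of sets which satisfy the quantitative regularity assumptions, in the form in
which they enter the local estimates: `P` bounds the number of touching elements, `L` the ratio of
the diameters of touching elements, and `K` compares the surface measure to a power of the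
diameter. -/
structure RegularMesh {d : ℕ} (𝒯 : Finset (Set (Euc d))) (P K : ℝ≥0) (L : ℝ) : Prop where
  measurableSet : ∀ T ∈ 𝒯, MeasurableSet T
  isBounded : ∀ T ∈ 𝒯, Bornology.IsBounded T
  diam_pos : ∀ T ∈ 𝒯, 0 < Metric.diam T
  measure_ne_top : ∀ T ∈ 𝒯, (μHE[d - 1] : Measure (Euc d)) T ≠ ∞
  measure_le : ∀ T ∈ 𝒯,
    (μHE[d - 1] : Measure (Euc d)) T ≤ K * ENNReal.ofReal (Metric.diam T ^ (d - 1))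
  le_measure : ∀ T ∈ 𝒯,
    ENNReal.ofReal (Metric.diam T ^ (d - 1)) ≤ K * (μHE[d - 1] : Measure (Euc d)) T
  card_touching_le : ∀ T ∈ 𝒯, ((touching 𝒯 T).card : ℝ≥0∞) ≤ P
  diam_le : ∀ T ∈ 𝒯, ∀ T' ∈ touching 𝒯 T, Metric.diam T ≤ L * Metric.diam T'

theorem IsMesh.isCompact {d : ℕ} {Γ : Set (Euc d)} {𝒯 : Finset (Set (Euc d))} (h : IsMesh Γ 𝒯)
    {T : Set (Euc d)} (hT : T ∈ 𝒯) : IsCompact T := by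
  obtain ⟨S, γ, ⟨U, -, hU, -, rfl⟩, rfl, L, hL, hγ⟩ := h.element T hT
  refine hU.isCompact_closure.image_of_continuousOn ?_
  have : LipschitzOnWith L.toNNReal γ (closure U) :=
    LipschitzOnWith.of_dist_le_mul fun s hs t ht => by
      rw [Real.coe_toNNReal _ hL.le]
      exact (hγ s hs t ht).2
  exact this.continuousOn

/-- The quotient `diam T / h_T` is set to `0` for `h_T = 0`, so that the lower bound of
shape-regularity excludes elements of measure zero or infinity and of diameter zero. -/
theorem IsMesh.regularMesh {d : ℕ} (hd : 2 ≤ d) {Γ : Set (Euc d)} {𝒯 : Finset (Set (Euc d))}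
    (h : IsMesh Γ 𝒯) {Cpatch Clocuni Cshape : ℝ} (hshape : 0 < Cshape)
    (hp : BoundedPatch 𝒯 Cpatch) (hl : LocallyQuasiUniform 𝒯 Clocuni)
    (hs : ShapeRegular 𝒯 Cshape) :
    RegularMesh 𝒯 Cpatch.toNNReal (Cshape ^ (d - 1)).toNNReal Clocuni := by
  have hquot : ∀ T ∈ 𝒯, 0 < Metric.diam T / meshWidth T := fun T hT =>
    lt_of_lt_of_le (inv_pos.2 hshape) (hs T hT).1
  have hwidth : ∀ T : Set (Euc d), 0 ≤ meshWidth T := fun T => by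
    unfold meshWidth; positivity
  have hd1 : (0 : ℝ) < (d : ℝ) - 1 := by
    have : (2 : ℝ) ≤ d := by exact_mod_cast hd
    linarith
  have hdiam : ∀ T ∈ 𝒯, 0 < Metric.diam T := fun T hT => by
    refine lt_of_le_of_ne Metric.diam_nonneg fun h0 => ?_
    have := hquot T hT
    simp [← h0] at this
  have hwpos : ∀ T ∈ 𝒯, 0 < meshWidth T := fun T hT => by
    refine lt_of_le_of_ne (hwidth T) fun h0 => ?_
    have := hquot T hT
    simp [← h0] at this
  have hpow : ∀ T : Set (Euc d),
      meshWidth T ^ (d - 1) = (μHE[d - 1] : Measure (Euc d)).real T := fun T => by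
    unfold meshWidth
    rw [← Real.rpow_mul_natCast measureReal_nonneg, Nat.cast_sub (by omega), Nat.cast_one,
      one_div_mul_cancel hd1.ne', Real.rpow_one]
  have htop : ∀ T ∈ 𝒯, (μHE[d - 1] : Measure (Euc d)) T ≠ ∞ := fun T hT h0 => by
    have h1 := hpow T
    rw [measureReal_def, h0, ENNReal.toReal_top] at h1
    exact (pow_pos (hwpos T hT) _).ne' h1
  have hmeas : ∀ T ∈ 𝒯, (μHE[d - 1] : Measure (Euc d)) T =
      ENNReal.ofReal (meshWidth T ^ (d - 1)) := fun T hT => by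
    rw [hpow, ofReal_measureReal (htop T hT)]
  refine ⟨fun T hT => (h.isCompact hT).measurableSet, fun T hT => (h.isCompact hT).isBounded,
    hdiam, htop, fun T hT => ?_, fun T hT => ?_, fun T hT => ?_, fun T hT T' hT' => ?_⟩
  · rw [hmeas T hT, ← ENNReal.ofReal, ← ENNReal.ofReal_mul (by positivity), ← mul_pow]
    refine ENNReal.ofReal_le_ofReal (pow_le_pow_left₀ (hwidth T) ?_ _)
    have := (hs T hT).1
    rw [le_div_iff₀ (hwpos T hT), inv_mul_le_iff₀ hshape] at this
    exact this
  · rw [hmeas T hT, ← ENNReal.ofReal, ← ENNReal.ofReal_mul (by positivity), ← mul_pow]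
    refine ENNReal.ofReal_le_ofReal (pow_le_pow_left₀ (hdiam T hT).le ?_ _)
    have := (hs T hT).2
    rwa [div_le_iff₀ (hwpos T hT)] at this
  · have h1 : ((touching 𝒯 T).card : ℝ) ≤ Cpatch :=
      (Nat.cast_le.2 (Finset.card_le_card touching_subset_patchElements)).trans (hp T hT)
    calc ((touching 𝒯 T).card : ℝ≥0∞) = ENNReal.ofReal ((touching 𝒯 T).card : ℝ) := by simp
      _ ≤ ENNReal.ofReal Cpatch := ENNReal.ofReal_le_ofReal h1
  · have := hl T hT T' (touching_subset_patchElements hT')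
    rwa [div_le_iff₀ (hdiam T' (mem_touching.1 hT').1)] at this

/-! ### Oscillation on elements and patches -/

/-- The factor `diam(T)^{-2σ}` by which squared `L²`-norms on `T` are scaled. -/
noncomputable def scaleWeight {d : ℕ} (σ : ℝ) (T : Set (Euc d)) : ℝ≥0∞ :=
  ENNReal.ofReal (Metric.diam T ^ (-(2 * σ)))

/-- The contribution of `T` to the localized seminorm. -/
noncomputable def patchSeminormSq {d : ℕ} (σ : ℝ) (𝒯 : Finset (Set (Euc d))) (u : Euc d → ℂ)
    (T : Set (Euc d)) : ℝ≥0∞ :=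
  ∑ T' ∈ patchElements 𝒯 1 T, seminormSq σ (T ∪ T') u

theorem seminormSq_le_patchSeminormSq {d : ℕ} {σ : ℝ} {𝒯 : Finset (Set (Euc d))} {u : Euc d → ℂ}
    {T T' : Set (Euc d)} (h : T' ∈ touching 𝒯 T) :
    seminormSq σ (T ∪ T') u ≤ patchSeminormSq σ 𝒯 u T :=
  Finset.single_le_sum (f := fun T' => seminormSq σ (T ∪ T') u) (fun _ _ => zero_le)
    (touching_subset_patchElements h)

theorem lintegral_biUnion_finset_le {α ι : Type*} [MeasurableSpace α] (μ : Measure α)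
    (s : Finset ι) (t : ι → Set α) (f : α → ℝ≥0∞) :
    ∫⁻ x in ⋃ i ∈ s, t i, f x ∂μ ≤ ∑ i ∈ s, ∫⁻ x in t i, f x ∂μ := by
  have := lintegral_iUnion_le (μ := μ) (fun i : s => t i) f
  rwa [Set.iUnion_subtype, tsum_fintype,
    Finset.sum_coe_sort s fun i => ∫⁻ x in t i, f x ∂μ] at this

theorem enorm_sub_sq_le {E : Type*} [SeminormedAddCommGroup E] (a b c : E) :
    ‖a - c‖ₑ ^ 2 ≤ 2 * ‖b - c‖ₑ ^ 2 + 2 * ‖a - b‖ₑ ^ 2 := by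
  have h1 : ‖a - c‖₊ ^ 2 ≤ 2 * ‖b - c‖₊ ^ 2 + 2 * ‖a - b‖₊ ^ 2 := by
    calc ‖a - c‖₊ ^ 2 ≤ (‖b - c‖₊ + ‖a - b‖₊) ^ 2 := by
          gcongr
          rw [add_comm]
          simpa using nnnorm_add_le (a - b) (b - c)
      _ ≤ 2 * (‖b - c‖₊ ^ 2 + ‖a - b‖₊ ^ 2) := add_sq_le
      _ = _ := by ring
  simp only [enorm_eq_nnnorm]
  exact_mod_cast h1

/-- The kernel is at least `R ^ (-s)` on pairs of points of distance at most `R`. -/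
theorem lintegral_lintegral_enorm_sub_sq_le {d : ℕ} (hd : 2 ≤ d) {σ : ℝ} (hσ : 0 < σ)
    {A B : Set (Euc d)} (hA : MeasurableSet A) (hB : MeasurableSet B) (u : Euc d → ℂ) {R : ℝ}
    (hR : ∀ y ∈ A, ∀ x ∈ B, dist x y ≤ R) :
    ∫⁻ y in A, ∫⁻ x in B, ‖u x - u y‖ₑ ^ 2 ∂μHE[d - 1] ∂μHE[d - 1] ≤
      ENNReal.ofReal (R ^ ((d : ℝ) - 1 + 2 * σ)) * seminormSq σ (A ∪ B) u := by
  have hs : 0 < (d : ℝ) - 1 + 2 * σ := by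
    have : (2 : ℝ) ≤ d := by exact_mod_cast hd
    linarith
  calc _ ≤ ∫⁻ y in A, ∫⁻ x in B, ENNReal.ofReal (R ^ ((d : ℝ) - 1 + 2 * σ)) *
        ENNReal.ofReal (‖u x - u y‖ ^ 2 / dist x y ^ ((d : ℝ) - 1 + 2 * σ))
          ∂μHE[d - 1] ∂μHE[d - 1] := by
        refine setLIntegral_mono' hA fun y hy => setLIntegral_mono' hB fun x hx => ?_
        rcases eq_or_ne x y with rfl | hxy
        · simp
        have hxy := dist_pos.2 hxy
        have hR0 := hxy.trans_le (hR y hy x hx)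
        rw [← ENNReal.ofReal_mul (by positivity), ← ofReal_norm, ← ENNReal.ofReal_pow (by simp)]
        refine ENNReal.ofReal_le_ofReal ?_
        rw [← mul_div_assoc, le_div_iff₀ (by positivity), mul_comm]
        gcongr
        exact hR y hy x hx
    _ = ENNReal.ofReal (R ^ ((d : ℝ) - 1 + 2 * σ)) * ∫⁻ y in A, ∫⁻ x in B,
        ENNReal.ofReal (‖u x - u y‖ ^ 2 / dist x y ^ ((d : ℝ) - 1 + 2 * σ))
          ∂μHE[d - 1] ∂μHE[d - 1] := by
        simp only [lintegral_const_mul' _ _ ENNReal.ofReal_ne_top]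
    _ ≤ _ := by
        gcongr
        refine (lintegral_mono fun y => lintegral_mono_set Set.subset_union_right).trans
          (lintegral_mono_set Set.subset_union_left)

theorem dist_le_of_touching {d : ℕ} {T T' : Set (Euc d)} (hT : Bornology.IsBounded T)
    (hT' : Bornology.IsBounded T') (h : (T' ∩ T).Nonempty) {L : ℝ}
    (hL : Metric.diam T' ≤ L * Metric.diam T) :
    ∀ y ∈ T, ∀ x ∈ T', dist x y ≤ (1 + L) * Metric.diam T := by
  intro y hy x hx
  obtain ⟨z, hz', hz⟩ := h
  have h1 := Metric.dist_le_diam_of_mem hT' hx hz'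
  have h2 := Metric.dist_le_diam_of_mem hT hz hy
  linarith [dist_triangle x z y]

/-- The powers of the diameter balance: `diam ^ s` from the kernel and `diam ^ (-2σ)` from the weight
multiply to `diam ^ n`, which is comparable to the surface measure. -/
theorem ofReal_mul_rpow {n : ℕ} {σ M h : ℝ} (hM : 0 ≤ M) (hh : 0 < h) :
    ENNReal.ofReal ((M * h) ^ ((n : ℝ) + 2 * σ)) * ENNReal.ofReal (h ^ (-(2 * σ))) =
      ENNReal.ofReal (M ^ ((n : ℝ) + 2 * σ)) * ENNReal.ofReal (h ^ n) := by
  rw [← ENNReal.ofReal_mul (by positivity), ← ENNReal.ofReal_mul (by positivity),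
    Real.mul_rpow hM hh.le, mul_assoc, ← Real.rpow_add hh]
  simp

theorem RegularMesh.scaleWeight_le {d : ℕ} {𝒯 : Finset (Set (Euc d))} {P K : ℝ≥0} {L : ℝ}
    (h𝒯 : RegularMesh 𝒯 P K L) (hL : 0 < L) {σ : ℝ} (hσ : 0 < σ) {T T' : Set (Euc d)}
    (hT : T ∈ 𝒯) (hTT' : T' ∈ touching 𝒯 T) :
    scaleWeight σ T' ≤ (L ^ (2 * σ)).toNNReal * scaleWeight σ T := by
  have hdT := h𝒯.diam_pos T hT
  have hdT' := h𝒯.diam_pos T' (mem_touching.1 hTT').1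
  have hle := h𝒯.diam_le T hT T' hTT'
  unfold scaleWeight
  rw [← ENNReal.ofReal, ← ENNReal.ofReal_mul (by positivity)]
  refine ENNReal.ofReal_le_ofReal ?_
  have : Metric.diam T ^ (2 * σ) ≤ L ^ (2 * σ) * Metric.diam T' ^ (2 * σ) := by
    rw [← Real.mul_rpow hL.le hdT'.le]
    gcongr
  rw [Real.rpow_neg hdT.le, Real.rpow_neg hdT'.le, ← div_eq_mul_inv, le_div_iff₀ (by positivity),
    inv_mul_le_iff₀ (by positivity)]
  linarith

/-- Transfer of a weighted `L²`-estimate from an element to a neighbour. The inequality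
`|u x - c|² ≤ 2 |u y - c|² + 2 |u x - u y|²` is integrated over `x ∈ T'` and `y ∈ T`. -/
theorem RegularMesh.exists_neighbour_bound {d : ℕ} (hd : 2 ≤ d) {σ : ℝ} (hσ : 0 < σ)
    (P K : ℝ≥0) {L : ℝ} (hL : 0 < L) :
    ∃ C : ℝ≥0, ∀ 𝒯 : Finset (Set (Euc d)), RegularMesh 𝒯 P K L →
      ∀ u : Euc d → ℂ, Measurable u → ∀ T ∈ 𝒯, ∀ T' ∈ touching 𝒯 T, ∀ c : ℂ,
      scaleWeight σ T' * ∫⁻ x in T', ‖u x - c‖ₑ ^ 2 ∂μHE[d - 1] ≤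
        C * (scaleWeight σ T * ∫⁻ x in T, ‖u x - c‖ₑ ^ 2 ∂μHE[d - 1] +
          patchSeminormSq σ 𝒯 u T) := by
  let c₁ : ℝ≥0 := 2 * (L ^ (2 * σ)).toNNReal * (K * (L ^ (d - 1)).toNNReal * K)
  let c₂ : ℝ≥0 := 2 * (L ^ (2 * σ)).toNNReal * ((1 + L) ^ (((d - 1 : ℕ) : ℝ) + 2 * σ)).toNNReal * K
  refine ⟨c₁ + c₂, fun 𝒯 h𝒯 u hu T hT T' hTT' c => ?_⟩
  have hT' := (mem_touching.1 hTT').1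
  have hdT := h𝒯.diam_pos T hT
  have hle' := h𝒯.diam_le T' hT' T (mem_touching_comm hT hTT')
  have hd1 : (d : ℝ) - 1 = ((d - 1 : ℕ) : ℝ) := by
    rw [Nat.cast_sub (by omega), Nat.cast_one]
  set μ : Measure (Euc d) := μHE[d - 1] with hμ
  set I := ∫⁻ x in T', ‖u x - c‖ₑ ^ 2 ∂μ with hI
  set J := ∫⁻ x in T, ‖u x - c‖ₑ ^ 2 ∂μ with hJ
  set Q := patchSeminormSq σ 𝒯 u T with hQ
  have hμ0 : μ T ≠ 0 := fun h0 => by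
    have := h𝒯.le_measure T hT
    rw [← hμ, h0, mul_zero, nonpos_iff_eq_zero, ENNReal.ofReal_eq_zero] at this
    exact (pow_pos hdT _).not_ge this
  have hμt : μ T ≠ ∞ := h𝒯.measure_ne_top T hT
  have hw := h𝒯.scaleWeight_le hL hσ hT hTT'
  have hmeas : μ T' ≤ K * (L ^ (d - 1)).toNNReal * K * μ T := by
    calc μ T' ≤ K * ENNReal.ofReal (Metric.diam T' ^ (d - 1)) := h𝒯.measure_le T' hT'
      _ ≤ K * ENNReal.ofReal (L ^ (d - 1) * Metric.diam T ^ (d - 1)) := by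
          rw [← mul_pow]; gcongr
      _ = K * ((L ^ (d - 1)).toNNReal * ENNReal.ofReal (Metric.diam T ^ (d - 1))) := by
          rw [ENNReal.ofReal_mul (by positivity), ENNReal.ofReal]
      _ ≤ K * ((L ^ (d - 1)).toNNReal * (K * μ T)) := by
          gcongr; exact h𝒯.le_measure T hT
      _ = _ := by ring
  have hpair : μ T * I ≤ 2 * μ T' * J + 2 *
      (ENNReal.ofReal (((1 + L) * Metric.diam T) ^ (((d - 1 : ℕ) : ℝ) + 2 * σ)) * Q) := by
    calc μ T * I = ∫⁻ y in T, ∫⁻ x in T', ‖u x - c‖ₑ ^ 2 ∂μ ∂μ := by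
          rw [lintegral_const, Measure.restrict_apply_univ, mul_comm]
      _ ≤ ∫⁻ y in T, ∫⁻ x in T', (2 * ‖u y - c‖ₑ ^ 2 + 2 * ‖u x - u y‖ₑ ^ 2) ∂μ ∂μ :=
          lintegral_mono fun y => lintegral_mono fun x => enorm_sub_sq_le _ _ _
      _ = ∫⁻ y in T, (2 * μ T' * ‖u y - c‖ₑ ^ 2 + 2 * ∫⁻ x in T', ‖u x - u y‖ₑ ^ 2 ∂μ) ∂μ := by
          refine lintegral_congr fun y => ?_
          rw [lintegral_add_left measurable_const, lintegral_const, Measure.restrict_apply_univ,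
            lintegral_const_mul' _ _ (by simp)]
          ring
      _ = 2 * μ T' * J + 2 * ∫⁻ y in T, ∫⁻ x in T', ‖u x - u y‖ₑ ^ 2 ∂μ ∂μ := by
          rw [lintegral_add_left (by fun_prop), lintegral_const_mul _ (by fun_prop),
            lintegral_const_mul' _ _ (by simp)]
      _ ≤ _ := by
          gcongr
          refine (lintegral_lintegral_enorm_sub_sq_le hd hσ (h𝒯.measurableSet T hT)
            (h𝒯.measurableSet T' hT') u (dist_le_of_touching (h𝒯.isBounded T hT)
            (h𝒯.isBounded T' hT') (mem_touching.1 hTT').2 hle')).trans ?_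
          rw [hd1]
          gcongr
          exact seminormSq_le_patchSeminormSq hTT'
  have key : μ T * (scaleWeight σ T' * I) ≤ μ T * (c₁ * (scaleWeight σ T * J) + c₂ * Q) := by
    calc μ T * (scaleWeight σ T' * I) ≤ (L ^ (2 * σ)).toNNReal * scaleWeight σ T * (μ T * I) := by
          rw [mul_left_comm]; gcongr
      _ ≤ (L ^ (2 * σ)).toNNReal * scaleWeight σ T *
          (2 * (K * (L ^ (d - 1)).toNNReal * K * μ T) * J + 2 *
          (ENNReal.ofReal (((1 + L) * Metric.diam T) ^ (((d - 1 : ℕ) : ℝ) + 2 * σ)) * Q)) := by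
          refine mul_le_mul_right (hpair.trans ?_) _
          gcongr
      _ = μ T * (c₁ * (scaleWeight σ T * J)) + 2 * (L ^ (2 * σ)).toNNReal *
          (ENNReal.ofReal (((1 + L) * Metric.diam T) ^ (((d - 1 : ℕ) : ℝ) + 2 * σ)) *
            scaleWeight σ T) * Q := by
          simp only [c₁]; push_cast; ring
      _ ≤ μ T * (c₁ * (scaleWeight σ T * J)) + 2 * (L ^ (2 * σ)).toNNReal *
          (((1 + L) ^ (((d - 1 : ℕ) : ℝ) + 2 * σ)).toNNReal * (K * μ T)) * Q := by
          unfold scaleWeight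
          rw [ofReal_mul_rpow (by positivity) hdT, ENNReal.ofReal]
          refine add_le_add_right (mul_le_mul_left (mul_le_mul_right
            (mul_le_mul_right (h𝒯.le_measure T hT) _) _) _) _
      _ = _ := by simp only [c₂]; push_cast; ring
  have := (ENNReal.mul_le_mul_iff_right hμ0 hμt).1 key
  refine this.trans ?_
  push_cast
  rw [mul_add]
  gcongr
  · exact le_self_add
  · exact le_add_self

/-- Some value of `u` on `T` approximates `u` up to the local seminorm: averaged over `y ∈ T`, the
squared distance of `u` to `u y` is a double integral over `T × T`. -/
theorem RegularMesh.exists_const_bound {d : ℕ} (hd : 2 ≤ d) {σ : ℝ} (hσ : 0 < σ)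
    (P K : ℝ≥0) (L : ℝ) :
    ∃ C : ℝ≥0, ∀ 𝒯 : Finset (Set (Euc d)), RegularMesh 𝒯 P K L →
      ∀ u : Euc d → ℂ, Measurable u → ∀ T ∈ 𝒯, ∃ c : ℂ,
      scaleWeight σ T * ∫⁻ x in T, ‖u x - c‖ₑ ^ 2 ∂μHE[d - 1] ≤
        C * patchSeminormSq σ 𝒯 u T := by
  refine ⟨K, fun 𝒯 h𝒯 u hu T hT => ?_⟩
  have hdT := h𝒯.diam_pos T hT
  have hd1 : (d : ℝ) - 1 = ((d - 1 : ℕ) : ℝ) := by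
    rw [Nat.cast_sub (by omega), Nat.cast_one]
  have hne : T.Nonempty := by
    by_contra h0
    rw [Set.not_nonempty_iff_eq_empty] at h0
    simp [h0] at hdT
  have hTT : T ∈ touching 𝒯 T := mem_touching.2 ⟨hT, by rwa [Set.inter_self]⟩
  set μ : Measure (Euc d) := μHE[d - 1] with hμ
  have hμ0 : μ T ≠ 0 := fun h0 => by
    have := h𝒯.le_measure T hT
    rw [← hμ, h0, mul_zero, nonpos_iff_eq_zero, ENNReal.ofReal_eq_zero] at this
    exact (pow_pos hdT _).not_ge this
  have hμt : μ T ≠ ∞ := h𝒯.measure_ne_top T hT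
  have : IsFiniteMeasure (μ.restrict T) := ⟨by simpa using hμt.lt_top⟩
  have hmeas : Measurable fun y => ∫⁻ x in T, ‖u x - u y‖ₑ ^ 2 ∂μ :=
    Measurable.lintegral_prod_right' (f := fun p : Euc d × Euc d => ‖u p.2 - u p.1‖ₑ ^ 2)
      (by fun_prop)
  obtain ⟨y, -, hy⟩ := exists_le_setLAverage hμ0 hμt hmeas.aemeasurable
  refine ⟨u y, ?_⟩
  rw [setLAverage_eq, ENNReal.le_div_iff_mul_le (.inl hμ0) (.inl hμt)] at hy
  refine (ENNReal.mul_le_mul_iff_right hμ0 hμt).1 ?_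
  calc _ = scaleWeight σ T * ((∫⁻ x in T, ‖u x - u y‖ₑ ^ 2 ∂μ) * μ T) := by ring
    _ ≤ scaleWeight σ T * (ENNReal.ofReal ((1 * Metric.diam T) ^ (((d - 1 : ℕ) : ℝ) + 2 * σ)) *
          patchSeminormSq σ 𝒯 u T) := by
        refine mul_le_mul_right ?_ _
        refine hy.trans ((lintegral_lintegral_enorm_sub_sq_le hd hσ (h𝒯.measurableSet T hT)
          (h𝒯.measurableSet T hT) u (R := 1 * Metric.diam T) fun y hy x hx => ?_).trans ?_)
        · rw [one_mul]; exact Metric.dist_le_diam_of_mem (h𝒯.isBounded T hT) hx hy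
        · rw [hd1]
          gcongr
          exact seminormSq_le_patchSeminormSq hTT
    _ = (ENNReal.ofReal ((1 * Metric.diam T) ^ (((d - 1 : ℕ) : ℝ) + 2 * σ)) * scaleWeight σ T) *
          patchSeminormSq σ 𝒯 u T := by ring
    _ ≤ (K * μ T) * patchSeminormSq σ 𝒯 u T := by
        unfold scaleWeight
        rw [ofReal_mul_rpow zero_le_one hdT, Real.one_rpow, ENNReal.ofReal_one, one_mul]
        gcongr
        exact h𝒯.le_measure T hT
    _ = _ := by ring

/-- The localized seminorm accumulated along chains of at most `k` touching elements, starting at `T`.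
An element is counted as often as there are chains that end in it. -/
noncomputable def chainSeminormSq {d : ℕ} (σ : ℝ) (𝒯 : Finset (Set (Euc d))) (u : Euc d → ℂ) :
    ℕ → Set (Euc d) → ℝ≥0∞
  | 0, _ => 0
  | k + 1, T => patchSeminormSq σ 𝒯 u T + ∑ T' ∈ touching 𝒯 T, chainSeminormSq σ 𝒯 u k T'

/-- Touching is symmetric, so that in the double sum each element is counted at most `P` times. -/
theorem RegularMesh.sum_sum_touching_le {d : ℕ} {𝒯 : Finset (Set (Euc d))} {P K : ℝ≥0} {L : ℝ}
    (h : RegularMesh 𝒯 P K L) (f : Set (Euc d) → ℝ≥0∞) :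
    ∑ T ∈ 𝒯, ∑ T' ∈ touching 𝒯 T, f T' ≤ P * ∑ T ∈ 𝒯, f T := by
  rw [Finset.sum_comm' (t' := 𝒯) (s' := touching 𝒯), Finset.mul_sum]
  · refine Finset.sum_le_sum fun T hT => ?_
    rw [Finset.sum_const, nsmul_eq_mul]
    exact mul_le_mul_left (h.card_touching_le T hT) _
  · intro T T'
    exact ⟨fun hh => ⟨mem_touching_comm hh.1 hh.2, (mem_touching.1 hh.2).1⟩,
      fun hh => ⟨(mem_touching.1 hh.1).1, mem_touching_comm hh.2 hh.1⟩⟩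

theorem RegularMesh.sum_chainSeminormSq_le {d : ℕ} {𝒯 : Finset (Set (Euc d))} {P K : ℝ≥0} {L : ℝ}
    (h : RegularMesh 𝒯 P K L) (σ : ℝ) (u : Euc d → ℂ) (k : ℕ) :
    ∑ T ∈ 𝒯, chainSeminormSq σ 𝒯 u k T ≤
      ((∑ i ∈ Finset.range k, P ^ i : ℝ≥0) : ℝ≥0∞) * ∑ T ∈ 𝒯, patchSeminormSq σ 𝒯 u T := by
  induction k with
  | zero => simp [chainSeminormSq]
  | succ k ih =>
    simp only [chainSeminormSq, Finset.sum_add_distrib]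
    refine (add_le_add_right ((h.sum_sum_touching_le _).trans (mul_le_mul_right ih _)) _).trans ?_
    rw [Finset.sum_range_succ']
    simp only [pow_succ', ← Finset.mul_sum]
    push_cast
    exact le_of_eq (by ring)

/-- Weighted `L²`-estimates on patches. The first element of each chain is split off in the induction,
so that the induction hypothesis is applied to the neighbours `T'` of `T`. -/
theorem RegularMesh.exists_patch_bound {d : ℕ} (hd : 2 ≤ d) {σ : ℝ} (hσ : 0 < σ)
    (P K : ℝ≥0) {L : ℝ} (hL : 0 < L) (k : ℕ) :
    ∃ C : ℝ≥0, ∀ 𝒯 : Finset (Set (Euc d)), RegularMesh 𝒯 P K L →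
      ∀ u : Euc d → ℂ, Measurable u → ∀ T ∈ 𝒯, ∀ c : ℂ,
      scaleWeight σ T * ∫⁻ x in patch 𝒯 k T, ‖u x - c‖ₑ ^ 2 ∂μHE[d - 1] ≤
        C * (scaleWeight σ T * ∫⁻ x in T, ‖u x - c‖ₑ ^ 2 ∂μHE[d - 1] +
          chainSeminormSq σ 𝒯 u k T) := by
  obtain ⟨C₁, hC₁⟩ := RegularMesh.exists_neighbour_bound hd hσ P K hL
  induction k with
  | zero => exact ⟨1, fun 𝒯 h𝒯 u hu T hT c => by simp [patch, chainSeminormSq]⟩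
  | succ k ih =>
    obtain ⟨C, hC⟩ := ih
    let M : ℝ≥0 := (L ^ (2 * σ)).toNNReal
    refine ⟨M * C * (P * C₁ + 1), fun 𝒯 h𝒯 u hu T hT c => ?_⟩
    set μ : Measure (Euc d) := μHE[d - 1] with hμ
    set a : Set (Euc d) → ℝ≥0∞ := fun T => scaleWeight σ T * ∫⁻ x in T, ‖u x - c‖ₑ ^ 2 ∂μ with ha
    have hw : ∀ T' ∈ touching 𝒯 T, scaleWeight σ T ≤ M * scaleWeight σ T' := fun T' hTT' =>
      h𝒯.scaleWeight_le hL hσ (mem_touching.1 hTT').1 (mem_touching_comm hT hTT')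
    calc _ ≤ scaleWeight σ T * ∑ T' ∈ touching 𝒯 T, ∫⁻ x in patch 𝒯 k T', ‖u x - c‖ₑ ^ 2 ∂μ := by
          gcongr
          refine (lintegral_mono_set (patch_succ_subset k)).trans ?_
          exact lintegral_biUnion_finset_le μ _ _ _
      _ = ∑ T' ∈ touching 𝒯 T, scaleWeight σ T * ∫⁻ x in patch 𝒯 k T', ‖u x - c‖ₑ ^ 2 ∂μ :=
          Finset.mul_sum _ _ _
      _ ≤ ∑ T' ∈ touching 𝒯 T, M * (C * (a T' + chainSeminormSq σ 𝒯 u k T')) := by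
          refine Finset.sum_le_sum fun T' hT' => ?_
          refine (mul_le_mul_left (hw T' hT') _).trans ?_
          rw [mul_assoc]
          exact mul_le_mul_right (hC 𝒯 h𝒯 u hu T' (mem_touching.1 hT').1 c) _
      _ = M * C * (∑ T' ∈ touching 𝒯 T, a T' +
            ∑ T' ∈ touching 𝒯 T, chainSeminormSq σ 𝒯 u k T') := by
          rw [← Finset.sum_add_distrib, Finset.mul_sum]
          exact Finset.sum_congr rfl fun _ _ => by ring
      _ ≤ M * C * (P * (C₁ * (a T + patchSeminormSq σ 𝒯 u T)) +
            ∑ T' ∈ touching 𝒯 T, chainSeminormSq σ 𝒯 u k T') := by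
          gcongr
          refine (Finset.sum_le_card_nsmul _ _ _
            fun T' hT' => hC₁ 𝒯 h𝒯 u hu T hT T' hT' c).trans ?_
          rw [nsmul_eq_mul]
          gcongr
          exact h𝒯.card_touching_le T hT
      _ ≤ _ := by
          rw [chainSeminormSq]
          push_cast
          rw [mul_assoc (M * C : ℝ≥0∞)]
          gcongr
          rw [add_mul, one_mul, ← mul_assoc, ← add_assoc (a T), mul_add _ (a T + _) (Finset.sum _ _),
            add_assoc]
          gcongr
          exact le_trans (le_add_self) le_add_self

/-! ### Functions orthogonal to a local approximation of unity -/

/-- A vector which is orthogonal to an approximation `ψ` of `e` is controlled by its distance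
to the line spanned by `e`. -/
theorem norm_le_of_inner_eq_zero {E : Type*} [NormedAddCommGroup E] [InnerProductSpace ℂ E]
    {v ψ e : E} {ρ : ℝ} (hρ₀ : 0 ≤ ρ) (h : inner ℂ v ψ = 0) (hψ : ‖e - ψ‖ ≤ ρ * ‖e‖) (c : ℂ) :
    (1 - ρ) * ‖v‖ ≤ (1 + ρ) * ‖v - c • e‖ := by
  rcases eq_or_ne v 0 with rfl | hv
  · simp only [norm_zero, mul_zero]; positivity
  have hv := norm_pos_iff.2 hv
  -- Since `v ⟂ ψ`, the vector `e` may be replaced by `e - ψ` in `⟪v, v⟫ = ⟪v, v - c e⟫ + c ⟪v, e⟫`.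
  have h1 : inner ℂ v v = inner ℂ v (v - c • e) + c * inner ℂ v (e - ψ) := by
    rw [inner_sub_right, inner_sub_right v e, h, inner_smul_right]; ring
  have h2 : ‖v‖ * ‖v‖ ≤ ‖v‖ * ‖v - c • e‖ + ‖c‖ * (‖v‖ * (ρ * ‖e‖)) := by
    calc ‖v‖ * ‖v‖ = ‖inner ℂ v v‖ := by
          rw [inner_self_eq_norm_sq_to_K, norm_pow]; simp [sq]
      _ ≤ ‖inner ℂ v (v - c • e)‖ + ‖c * inner ℂ v (e - ψ)‖ := by rw [h1]; exact norm_add_le _ _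
      _ ≤ _ := by
          rw [norm_mul]
          gcongr
          · exact norm_inner_le_norm _ _
          · exact (norm_inner_le_norm _ _).trans (by gcongr)
  have h3 : ‖v‖ ≤ ‖v - c • e‖ + ρ * (‖c‖ * ‖e‖) := by
    refine le_of_mul_le_mul_left ?_ hv
    linarith
  have h4 : ‖c‖ * ‖e‖ ≤ ‖v‖ + ‖v - c • e‖ := by
    rw [← norm_smul]
    simpa using norm_sub_le v (v - c • e)
  nlinarith

theorem eLpNorm_two_sq {α F : Type*} [MeasurableSpace α] [NormedAddCommGroup F] (μ : Measure α)
    (f : α → F) : eLpNorm f 2 μ ^ 2 = ∫⁻ x, ‖f x‖ₑ ^ 2 ∂μ := by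
  have := eLpNorm_nnreal_pow_eq_lintegral (p := 2) (f := f) (μ := μ) two_ne_zero
  simpa only [NNReal.coe_ofNat, ENNReal.coe_ofNat, ENNReal.rpow_ofNat] using this

/-- The case of `L²`, with the constant function `1` as `e`. -/
theorem lintegral_enorm_sq_le_of_integral_inner_eq_zero {α : Type*} [MeasurableSpace α]
    {μ : Measure α} [IsFiniteMeasure μ] {u ψ : α → ℂ} (hu : MemLp u 2 μ) (hψ : MemLp ψ 2 μ)
    {ρ : ℝ} (hρ₀ : 0 ≤ ρ) (hρ₁ : ρ < 1) (h : ∫ x, inner ℂ (u x) (ψ x) ∂μ = 0)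
    (hone : eLpNorm (fun x => 1 - ψ x) 2 μ ≤ ENNReal.ofReal ρ * μ Set.univ ^ (1 / 2 : ℝ)) (c : ℂ) :
    ∫⁻ x, ‖u x‖ₑ ^ 2 ∂μ ≤ ENNReal.ofReal ((1 + ρ) / (1 - ρ)) ^ 2 * ∫⁻ x, ‖u x - c‖ₑ ^ 2 ∂μ := by
  have he : MemLp (fun _ : α => (1 : ℂ)) 2 μ := memLp_const 1
  have hcu : MemLp (fun x => u x - c) 2 μ := hu.sub (memLp_const c)
  have h1 : inner ℂ (hu.toLp u) (hψ.toLp ψ) = 0 := by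
    rw [L2.inner_def, ← h]
    refine integral_congr_ae ?_
    filter_upwards [hu.coeFn_toLp, hψ.coeFn_toLp] with x hx hx'
    rw [hx, hx']
  have h2 : ‖he.toLp _ - hψ.toLp ψ‖ ≤ ρ * ‖he.toLp _‖ := by
    rw [← MemLp.toLp_sub, Lp.norm_toLp, Lp.norm_toLp, ← ENNReal.toReal_ofReal hρ₀,
      ← ENNReal.toReal_mul]
    refine ENNReal.toReal_mono (ENNReal.mul_ne_top (by simp) he.2.ne) (hone.trans ?_)
    rcases eq_or_ne μ 0 with rfl | hμ
    · simp
    rw [eLpNorm_const _ (by simp) hμ]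
    simp
  have h3 := norm_le_of_inner_eq_zero hρ₀ h1 h2 c
  have h4 : hu.toLp u - c • he.toLp _ = hcu.toLp _ := by
    have : MemLp (c • fun _ : α => (1 : ℂ)) 2 μ := he.const_smul c
    rw [← MemLp.toLp_const_smul, ← MemLp.toLp_sub]
    congr 1
    ext x
    simp
  rw [h4, Lp.norm_toLp, Lp.norm_toLp, mul_comm, ← le_div_iff₀ (by linarith)] at h3
  rw [← eLpNorm_two_sq, ← eLpNorm_two_sq, ← mul_pow]
  refine pow_le_pow_left' ?_ 2
  rw [← ENNReal.ofReal_toReal hu.2.ne, ← ENNReal.ofReal_toReal hcu.2.ne,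
    ← ENNReal.ofReal_mul (div_nonneg (by linarith) (by linarith))]
  refine ENNReal.ofReal_le_ofReal (h3.trans (le_of_eq ?_))
  ring

theorem isClosed_essSupport {d : ℕ} (Γ : Set (Euc d)) {F : Type*} [Zero F] (f : Euc d → F) :
    IsClosed (essSupport Γ f) := by
  rw [← isOpen_compl_iff, isOpen_iff_forall_mem_open]
  intro x hx
  simp only [essSupport, Set.mem_compl_iff, Set.mem_ofPred_eq, not_forall, not_not] at hx
  obtain ⟨U, hU, hxU, h⟩ := hx
  exact ⟨U, fun y hy hmem => hmem U hU hy h, hU, hxU⟩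

/-- Functions vanish almost everywhere off their support, as `ℝᵈ` is second countable. -/
theorem ae_eq_zero_of_notMem_essSupport {d : ℕ} (Γ : Set (Euc d)) {F : Type*} [Zero F]
    (f : Euc d → F) : ∀ᵐ x ∂surfaceMeasure Γ, x ∉ essSupport Γ f → f x = 0 := by
  rw [ae_iff]
  refine measure_null_of_locally_null _ fun x hx => ?_
  simp only [Set.mem_ofPred_eq, Classical.not_imp] at hx
  have hx := hx.1
  simp only [essSupport, Set.mem_ofPred_eq, not_forall, not_not] at hx
  obtain ⟨U, hU, hxU, h⟩ := hx
  refine ⟨{x | f x = 0}ᶜ ∩ U, ?_, ?_⟩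
  · refine Filter.mem_of_superset (Filter.inter_mem self_mem_nhdsWithin
      (mem_nhdsWithin_of_mem_nhds (hU.mem_nhds hxU))) ?_
    rintro y ⟨hy, hyU⟩
    simp only [Set.mem_ofPred_eq, Classical.not_imp] at hy
    exact ⟨hy.2, hyU⟩
  · have := (ae_restrict_iff' hU.measurableSet).1 h
    rw [Filter.eventually_iff, mem_ae_iff] at this
    refine measure_mono_null ?_ this
    rintro y ⟨hy, hyU⟩ hh
    exact hy (hh hyU)

theorem essSupport_component_subset {d D : ℕ} (Γ : Set (Euc d))
    (f : Euc d → EuclideanSpace ℂ (Fin D)) (j : Fin D) :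
    (essSupport Γ fun x => f x j) ⊆ essSupport Γ f := by
  intro x hx U hU hxU h
  refine hx U hU hxU ?_
  filter_upwards [h] with y hy
  rw [hy]; rfl

/-- Functions orthogonal to a local unity are controlled by their distance to constants. -/
theorem IsLocalUnity.lintegral_enorm_sq_le {d D : ℕ} {Γ : Set (Euc d)}
    (hΓ : (μHE[d - 1] : Measure (Euc d)) Γ ≠ ∞) {𝒯 : Finset (Set (Euc d))} (h𝒯 : IsMesh Γ 𝒯)
    {X : Submodule ℂ (L2 Γ D)} {q : ℕ} {ρ : ℝ} (hρ₀ : 0 ≤ ρ) (hρ₁ : ρ < 1)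
    {Ψ : Set (Euc d) → Fin D → L2 Γ D} (hΨ : IsLocalUnity Γ 𝒯 X q ρ Ψ) {v : L2 Γ D}
    {T : Set (Euc d)} (hT : T ∈ 𝒯) {j : Fin D} (hv : inner ℂ v (Ψ T j) = 0) (c : ℂ) :
    ∫⁻ x in T, ‖v x j‖ₑ ^ 2 ∂μHE[d - 1] ≤ ENNReal.ofReal ((1 + ρ) / (1 - ρ)) ^ 2 *
      ∫⁻ x in patch 𝒯 q T, ‖v x j - c‖ₑ ^ 2 ∂μHE[d - 1] := by
  have hTΓ : T ⊆ Γ := by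
    rw [h𝒯.cover]
    exact Set.subset_biUnion_of_mem (u := fun T => T) hT
  have : IsFiniteMeasure (surfaceMeasure Γ) := ⟨by simpa [surfaceMeasure] using hΓ.lt_top⟩
  set S := essSupport Γ (Ψ T j) with hS
  have hSm : MeasurableSet S := (isClosed_essSupport Γ _).measurableSet
  have hcomp : ∀ f : L2 Γ D, MemLp (fun x => f x j) 2 (surfaceMeasure Γ) := fun f =>
    (Lp.memLp f).of_le ((Measurable.aestronglyMeasurable (by
      have := (Lp.stronglyMeasurable f).measurable
      fun_prop))) (.of_forall fun x => PiLp.norm_apply_le (f x) j)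
  have horth : ∫ x in S, inner ℂ (v x j) (Ψ T j x j) ∂surfaceMeasure Γ = 0 := by
    rw [setIntegral_eq_integral_of_ae_compl_eq_zero, ← hv, L2.inner_def]
    · refine integral_congr_ae ?_
      have : ∀ᵐ x ∂surfaceMeasure Γ, ∀ j', j' ≠ j → Ψ T j x j' = 0 := by
        rw [ae_all_iff]
        intro j'
        by_cases hj : j' = j
        · simp [hj]
        · filter_upwards [hΨ.component_eq_zero T hT j j' hj] with x hx _ using hx
      filter_upwards [this] with x hx
      rw [PiLp.inner_apply, Finset.sum_eq_single j (fun j' _ hj => by rw [hx j' hj]; simp)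
        (by simp)]
    · filter_upwards [ae_eq_zero_of_notMem_essSupport Γ (Ψ T j)] with x hx hxS
      rw [hx hxS]
      simp
  have hone : eLpNorm (fun x => 1 - Ψ T j x j) 2 ((surfaceMeasure Γ).restrict S) ≤
      ENNReal.ofReal ρ * ((surfaceMeasure Γ).restrict S) Set.univ ^ (1 / 2 : ℝ) := by
    refine (hΨ.approx_one T hT j).trans ?_
    rw [Measure.restrict_apply_univ]
    gcongr
    exact essSupport_component_subset Γ (Ψ T j) j
  calc _ = ∫⁻ x in T, ‖v x j‖ₑ ^ 2 ∂surfaceMeasure Γ := by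
        rw [show (surfaceMeasure Γ).restrict T = (μHE[d - 1] : Measure (Euc d)).restrict T from
          Measure.restrict_restrict_of_subset hTΓ]
    _ ≤ ∫⁻ x in S, ‖v x j‖ₑ ^ 2 ∂surfaceMeasure Γ := lintegral_mono_set (hΨ.subset_support T hT j)
    _ ≤ ENNReal.ofReal ((1 + ρ) / (1 - ρ)) ^ 2 *
          ∫⁻ x in S, ‖v x j - c‖ₑ ^ 2 ∂surfaceMeasure Γ :=
        lintegral_enorm_sq_le_of_integral_inner_eq_zero ((hcomp v).restrict S)
          ((hcomp _).restrict S) hρ₀ hρ₁ horth hone c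
    _ ≤ _ := by
        gcongr
        · exact hΨ.support_subset T hT j
        · exact Measure.restrict_le_self

/-! ### Localization of the seminorm -/

/-- On separated pairs, the cancellation in the numerator of the kernel is not needed. -/
theorem ofReal_div_le_add {d : ℕ} (u : Euc d → ℂ) (s : ℝ) (x y : Euc d) :
    ENNReal.ofReal (‖u x - u y‖ ^ 2 / dist x y ^ s) ≤
      2 * ‖u y‖ₑ ^ 2 * ENNReal.ofReal (dist y x ^ (-s)) +
      2 * ‖u x‖ₑ ^ 2 * ENNReal.ofReal (dist x y ^ (-s)) := by
  have h := enorm_sub_sq_le (u x) 0 (u y)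
  rw [zero_sub, enorm_neg, sub_zero] at h
  rw [dist_comm y x, ← add_mul, div_eq_mul_inv, ← Real.rpow_neg dist_nonneg,
    ENNReal.ofReal_mul (by positivity), ENNReal.ofReal_pow (norm_nonneg _), ofReal_norm]
  gcongr

open Classical in
/-- The elements of `𝒯` that do not touch `T`. -/
noncomputable def nonTouching {d : ℕ} (𝒯 : Finset (Set (Euc d))) (T : Set (Euc d)) :
    Finset (Set (Euc d)) :=
  𝒯.filter fun T' => ¬(T' ∩ T).Nonempty

theorem mem_nonTouching {d : ℕ} {𝒯 : Finset (Set (Euc d))} {T T' : Set (Euc d)} :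
    T' ∈ nonTouching 𝒯 T ↔ T' ∈ 𝒯 ∧ ¬(T' ∩ T).Nonempty := by
  simp [nonTouching]

theorem sum_touching_add_sum_nonTouching {d : ℕ} (𝒯 : Finset (Set (Euc d))) (T : Set (Euc d))
    (f : Set (Euc d) → ℝ≥0∞) :
    ∑ T' ∈ touching 𝒯 T, f T' + ∑ T' ∈ nonTouching 𝒯 T, f T' = ∑ T' ∈ 𝒯, f T' := by
  classical
  unfold touching nonTouching
  convert Finset.sum_filter_add_sum_filter_not 𝒯 (fun T' => (T' ∩ T).Nonempty) f

/-- Not touching is a symmetric relation. -/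
theorem sum_sum_nonTouching_comm {d : ℕ} (𝒯 : Finset (Set (Euc d)))
    (f : Set (Euc d) → Set (Euc d) → ℝ≥0∞) :
    ∑ T ∈ 𝒯, ∑ T' ∈ nonTouching 𝒯 T, f T' T = ∑ T ∈ 𝒯, ∑ T' ∈ nonTouching 𝒯 T, f T T' := by
  refine Finset.sum_comm' fun T T' => ?_
  simp only [nonTouching, Finset.mem_filter, Set.inter_comm T T']
  tauto

/-- Elements not touching `T` lie, up to a null set, outside of the patch of `T`. -/
theorem sum_nonTouching_lintegral_le {d : ℕ} {Γ : Set (Euc d)}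
    {𝒯 : Finset (Set (Euc d))} (h𝒯 : IsMesh Γ 𝒯) {Ccent : ℝ} (hcent : 0 < Ccent)
    (hc : CenteredInPatch Γ 𝒯 Ccent) {T : Set (Euc d)} (hT : T ∈ 𝒯) {y : Euc d} (hy : y ∈ T)
    (f : Euc d → ℝ≥0∞) :
    ∑ T' ∈ nonTouching 𝒯 T, ∫⁻ x in T', f x ∂μHE[d - 1] ≤
      ∫⁻ x in {x | Metric.diam T / Ccent ≤ dist y x}, f x ∂surfaceMeasure Γ := by
  have hsub : ∀ T' ∈ nonTouching 𝒯 T, T' ∈ 𝒯 := fun T' h => (mem_nonTouching.1 h).1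
  have hclosed : IsClosed {x | Metric.diam T / Ccent ≤ dist y x} :=
    isClosed_le continuous_const (by fun_prop)
  rw [← lintegral_biUnion_finset₀
    (fun T' hT' T'' hT'' hne => h𝒯.overlap T' (hsub T' hT') T'' (hsub T'' hT'') hne)
    (fun T' hT' => (h𝒯.isCompact (hsub T' hT')).measurableSet.nullMeasurableSet),
    surfaceMeasure, Measure.restrict_restrict hclosed.measurableSet]
  refine lintegral_mono_set' ?_
  -- A point of `T'` may lie in the patch of `T`, but then it lies in a second element.
  have hnull : (μHE[d - 1] : Measure (Euc d))
      (⋃ T' ∈ nonTouching 𝒯 T, ⋃ T'' ∈ touching 𝒯 T, T' ∩ T'') = 0 := by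
    refine (measure_biUnion_null_iff (Finset.countable_toSet _)).2 fun T' hT' =>
      (measure_biUnion_null_iff (Finset.countable_toSet _)).2 fun T'' hT'' => ?_
    refine h𝒯.overlap T' (hsub T' hT') T'' (mem_touching.1 hT'').1 ?_
    rintro rfl
    exact (mem_nonTouching.1 hT').2 (mem_touching.1 hT'').2
  filter_upwards [compl_mem_ae_iff.2 hnull] with x hx hxU
  obtain ⟨T', hT', hxT'⟩ := Set.mem_iUnion₂.1 hxU
  have hxΓ : x ∈ Γ := by
    rw [h𝒯.cover]
    exact Set.mem_iUnion₂.2 ⟨T', hsub T' hT', hxT'⟩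
  have hxp : x ∉ patch 𝒯 1 T := by
    rw [patch_one]
    intro hmem
    obtain ⟨T'', hT'', hxT''⟩ := Set.mem_iUnion₂.1 hmem
    exact hx (Set.mem_iUnion₂.2 ⟨T', hT', Set.mem_iUnion₂.2 ⟨T'', hT'', hxT', hxT''⟩⟩)
  refine ⟨?_, hxΓ⟩
  have h1 := hc T hT
  rw [setDist, if_pos ⟨x, hxΓ, hxp⟩] at h1
  change Metric.diam T / Ccent ≤ dist y x
  rw [div_le_iff₀' hcent]
  refine h1.trans ?_
  gcongr
  refine csInf_le ⟨0, ?_⟩ ⟨y, hy, x, ⟨hxΓ, hxp⟩, rfl⟩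
  rintro _ ⟨a, -, b, -, rfl⟩
  exact dist_nonneg

/-- Localization of the seminorm, with a remainder of scaled `L²`-norms. -/
theorem exists_seminormSq_le {d : ℕ} (hd : 2 ≤ d) {σ : ℝ} (hσ : 0 < σ) {Γ : Set (Euc d)}
    {A : ℝ≥0} (hΓ : ∀ (x : Euc d) (r : ℝ), 0 ≤ r →
      (μHE[d - 1] : Measure (Euc d)) (Γ ∩ Metric.closedBall x r)
        ≤ A * ENNReal.ofReal (r ^ (d - 1)))
    (P K : ℝ≥0) (L : ℝ) {Ccent : ℝ} (hcent : 0 < Ccent) :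
    ∃ C : ℝ≥0, ∀ 𝒯 : Finset (Set (Euc d)), IsMesh Γ 𝒯 → RegularMesh 𝒯 P K L →
      CenteredInPatch Γ 𝒯 Ccent → ∀ u : Euc d → ℂ, Measurable u →
      seminormSq σ Γ u ≤ ∑ T ∈ 𝒯, patchSeminormSq σ 𝒯 u T +
        C * ∑ T ∈ 𝒯, scaleWeight σ T * ∫⁻ x in T, ‖u x‖ₑ ^ 2 ∂μHE[d - 1] := by
  have hd1 : (d : ℝ) - 1 = ((d - 1 : ℕ) : ℝ) := by
    rw [Nat.cast_sub (by omega), Nat.cast_one]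
  obtain ⟨C, hC⟩ := lintegral_dist_rpow_neg_le (μ := surfaceMeasure Γ) (n := d - 1) (A := A)
    (fun x r hr => by
      rw [surfaceMeasure, Measure.restrict_apply Metric.isClosed_closedBall.measurableSet,
        Set.inter_comm]
      exact hΓ x r hr) (show 0 < 2 * σ by positivity)
  refine ⟨4 * C * (Ccent ^ (2 * σ)).toNNReal, fun 𝒯 h𝒯 hreg hc u hu => ?_⟩
  set μ : Measure (Euc d) := μHE[d - 1] with hμ
  set s : ℝ := (d : ℝ) - 1 + 2 * σ with hs
  set k : Euc d → Euc d → ℝ≥0∞ := fun y x => ENNReal.ofReal (‖u x - u y‖ ^ 2 / dist x y ^ s)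
  set G : Euc d → Euc d → ℝ≥0∞ := fun y x => 2 * ‖u y‖ₑ ^ 2 * ENNReal.ofReal (dist y x ^ (-s))
  have hkm : Measurable (Function.uncurry k) := by
    simp only [k, Function.uncurry_def]; fun_prop
  have hGm : Measurable (Function.uncurry G) := by
    simp only [G, Function.uncurry_def]; fun_prop
  have hfin : ∀ T ∈ 𝒯, IsFiniteMeasure (μ.restrict T) := fun T hT =>
    ⟨by simpa using (hreg.measure_ne_top T hT).lt_top⟩
  -- `G y x` is the half of the kernel bound that carries `u y`. Its integral over all `x` in elements
  -- away from `T` is an integral of the tail of the kernel.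
  have htail : ∀ T ∈ 𝒯, ∑ T' ∈ nonTouching 𝒯 T, ∫⁻ y in T, ∫⁻ x in T', G y x ∂μ ∂μ ≤
      2 * C * (Ccent ^ (2 * σ)).toNNReal * (scaleWeight σ T * ∫⁻ x in T, ‖u x‖ₑ ^ 2 ∂μ) := by
    intro T hT
    have hdT := hreg.diam_pos T hT
    rw [← lintegral_finsetSum' _ fun T' hT' => by
      have := hfin T' (mem_nonTouching.1 hT').1
      exact (hGm.lintegral_prod_right' (ν := μ.restrict T')).aemeasurable]
    calc _ ≤ ∫⁻ y in T, 2 * C * (Ccent ^ (2 * σ)).toNNReal * scaleWeight σ T * ‖u y‖ₑ ^ 2 ∂μ := by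
          refine setLIntegral_mono' (hreg.measurableSet T hT) fun y hy => ?_
          refine (sum_nonTouching_lintegral_le h𝒯 hcent hc hT hy _).trans ?_
          rw [lintegral_const_mul _ (by fun_prop)]
          have h1 := hC y (Metric.diam T / Ccent) (by positivity)
          rw [← hd1, ← hs] at h1
          refine (mul_le_mul_right h1 _).trans (le_of_eq ?_)
          · rw [Real.div_rpow hdT.le hcent.le, Real.rpow_neg hcent.le, div_inv_eq_mul,
              ENNReal.ofReal_mul (by positivity), scaleWeight,
              show ENNReal.ofReal (Ccent ^ (2 * σ)) = ((Ccent ^ (2 * σ)).toNNReal : ℝ≥0∞) from rfl]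
            ring
      _ = _ := by
          rw [lintegral_const_mul _ (by fun_prop)]
          ring
  calc seminormSq σ Γ u = ∫⁻ y in ⋃ T ∈ 𝒯, T, ∫⁻ x in ⋃ T ∈ 𝒯, T, k y x ∂μ ∂μ := by
        rw [← h𝒯.cover]; rfl
    _ ≤ ∑ T ∈ 𝒯, ∫⁻ y in T, ∑ T' ∈ 𝒯, ∫⁻ x in T', k y x ∂μ ∂μ :=
        (lintegral_biUnion_finset_le μ 𝒯 (fun T => T) _).trans <| Finset.sum_le_sum fun T _ =>
          lintegral_mono fun y => lintegral_biUnion_finset_le μ 𝒯 (fun T => T) _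
    _ = ∑ T ∈ 𝒯, ∑ T' ∈ 𝒯, ∫⁻ y in T, ∫⁻ x in T', k y x ∂μ ∂μ := by
        refine Finset.sum_congr rfl fun T _ => lintegral_finsetSum' _ fun T' hT' => ?_
        have := hfin T' hT'
        exact (hkm.lintegral_prod_right' (ν := μ.restrict T')).aemeasurable
    _ = ∑ T ∈ 𝒯, ∑ T' ∈ touching 𝒯 T, ∫⁻ y in T, ∫⁻ x in T', k y x ∂μ ∂μ +
          ∑ T ∈ 𝒯, ∑ T' ∈ nonTouching 𝒯 T, ∫⁻ y in T, ∫⁻ x in T', k y x ∂μ ∂μ := by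
        simp only [← Finset.sum_add_distrib, sum_touching_add_sum_nonTouching]
    _ ≤ ∑ T ∈ 𝒯, patchSeminormSq σ 𝒯 u T +
          ∑ T ∈ 𝒯, ∑ T' ∈ nonTouching 𝒯 T, (∫⁻ y in T, ∫⁻ x in T', G y x ∂μ ∂μ +
            ∫⁻ y in T', ∫⁻ x in T, G y x ∂μ ∂μ) := by
        refine add_le_add (Finset.sum_le_sum fun T _ => ?_)
          (Finset.sum_le_sum fun T hT => Finset.sum_le_sum fun T' hT' => ?_)
        · refine (Finset.sum_le_sum fun T' _ => ?_).trans
            (Finset.sum_le_sum_of_subset touching_subset_patchElements)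
          exact (lintegral_mono fun y => lintegral_mono_set Set.subset_union_right).trans
            (lintegral_mono_set Set.subset_union_left)
        · have := hfin T hT
          have := hfin T' (mem_nonTouching.1 hT').1
          -- By symmetry, the half with `u x` is the first one with `T` and `T'` exchanged.
          rw [lintegral_lintegral_swap (f := G) (μ := μ.restrict T') (ν := μ.restrict T)
            hGm.aemeasurable, ← lintegral_add_left
            (f := fun y => ∫⁻ x in T', G y x ∂μ) hGm.lintegral_prod_right']
          refine lintegral_mono fun y => ?_
          rw [← lintegral_add_left (by fun_prop)]
          exact lintegral_mono fun x => ofReal_div_le_add u s x y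
    _ = ∑ T ∈ 𝒯, patchSeminormSq σ 𝒯 u T +
          2 * ∑ T ∈ 𝒯, ∑ T' ∈ nonTouching 𝒯 T, ∫⁻ y in T, ∫⁻ x in T', G y x ∂μ ∂μ := by
        simp only [Finset.sum_add_distrib]
        rw [sum_sum_nonTouching_comm 𝒯 fun T T' => ∫⁻ y in T, ∫⁻ x in T', G y x ∂μ ∂μ, two_mul]
    _ ≤ ∑ T ∈ 𝒯, patchSeminormSq σ 𝒯 u T + 2 * ∑ T ∈ 𝒯, 2 * C * (Ccent ^ (2 * σ)).toNNReal *
          (scaleWeight σ T * ∫⁻ x in T, ‖u x‖ₑ ^ 2 ∂μ) := by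
        gcongr with T hT
        exact htail T hT
    _ = _ := by
        rw [← Finset.mul_sum]
        push_cast
        ring

/-! ### Summation over the mesh -/

/-- Scaled local Poincaré inequalities, summed over the mesh. -/
theorem exists_sum_scaleWeight_mul_lintegral_le {d : ℕ} (hd : 2 ≤ d) {σ : ℝ} (hσ : 0 < σ)
    {Γ : Set (Euc d)} (hΓ : (μHE[d - 1] : Measure (Euc d)) Γ ≠ ∞) (P K : ℝ≥0) {L : ℝ} (hL : 0 < L)
    (q : ℕ) {ρ : ℝ} (hρ₀ : 0 ≤ ρ) (hρ₁ : ρ < 1) :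
    ∃ C : ℝ≥0, ∀ 𝒯 : Finset (Set (Euc d)), IsMesh Γ 𝒯 → RegularMesh 𝒯 P K L →
      ∀ (D : ℕ) (X : Submodule ℂ (L2 Γ D)) (Ψ : Set (Euc d) → Fin D → L2 Γ D),
      IsLocalUnity Γ 𝒯 X q ρ Ψ → ∀ (v : L2 Γ D) (j : Fin D), (∀ T ∈ 𝒯, inner ℂ v (Ψ T j) = 0) →
      ∑ T ∈ 𝒯, scaleWeight σ T * ∫⁻ x in T, ‖v x j‖ₑ ^ 2 ∂μHE[d - 1] ≤
        C * ∑ T ∈ 𝒯, patchSeminormSq σ 𝒯 (fun x => v x j) T := by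
  obtain ⟨C₁, hC₁⟩ := RegularMesh.exists_const_bound hd hσ P K L
  obtain ⟨C₂, hC₂⟩ := RegularMesh.exists_patch_bound hd hσ P K hL q
  let R : ℝ≥0 := ((1 + ρ) / (1 - ρ)).toNNReal ^ 2
  let N : ℝ≥0 := ∑ i ∈ Finset.range q, P ^ i
  refine ⟨R * C₂ * (C₁ + N), fun 𝒯 h𝒯 hreg D X Ψ hΨ v j hv => ?_⟩
  set u : Euc d → ℂ := fun x => v x j
  have hu : Measurable u := by
    have := (Lp.stronglyMeasurable v).measurable
    fun_prop
  calc _ ≤ ∑ T ∈ 𝒯, R * C₂ * (C₁ * patchSeminormSq σ 𝒯 u T + chainSeminormSq σ 𝒯 u q T) := by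
        refine Finset.sum_le_sum fun T hT => ?_
        obtain ⟨c, hc⟩ := hC₁ 𝒯 hreg u hu T hT
        calc _ ≤ scaleWeight σ T *
              (R * ∫⁻ x in patch 𝒯 q T, ‖u x - c‖ₑ ^ 2 ∂μHE[d - 1]) := by
              gcongr
              exact hΨ.lintegral_enorm_sq_le hΓ h𝒯 hρ₀ hρ₁ hT (hv T hT) c
          _ = R * (scaleWeight σ T * ∫⁻ x in patch 𝒯 q T, ‖u x - c‖ₑ ^ 2 ∂μHE[d - 1]) := by ring
          _ ≤ R * (C₂ * (C₁ * patchSeminormSq σ 𝒯 u T + chainSeminormSq σ 𝒯 u q T)) := by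
              refine mul_le_mul_right ((hC₂ 𝒯 hreg u hu T hT c).trans ?_) _
              gcongr
          _ = _ := by ring
    _ = R * C₂ * (C₁ * ∑ T ∈ 𝒯, patchSeminormSq σ 𝒯 u T +
          ∑ T ∈ 𝒯, chainSeminormSq σ 𝒯 u q T) := by
        rw [← Finset.mul_sum, Finset.sum_add_distrib, ← Finset.mul_sum]
    _ ≤ R * C₂ * (C₁ * ∑ T ∈ 𝒯, patchSeminormSq σ 𝒯 u T +
          N * ∑ T ∈ 𝒯, patchSeminormSq σ 𝒯 u T) := by
        gcongr
        exact hreg.sum_chainSeminormSq_le σ u q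
    _ = _ := by push_cast; ring

/-- As `diam T ≤ diam Γ`, the weights are bounded from below. -/
theorem eLpNorm_sq_le_sum_scaleWeight {d : ℕ} {σ : ℝ} (hσ : 0 < σ) {Γ : Set (Euc d)}
    (hΓ : Bornology.IsBounded Γ) {𝒯 : Finset (Set (Euc d))} (h𝒯 : IsMesh Γ 𝒯)
    (hdiam : ∀ T ∈ 𝒯, 0 < Metric.diam T) (u : Euc d → ℂ) :
    eLpNorm u 2 ((μHE[d - 1] : Measure (Euc d)).restrict Γ) ^ 2 ≤
      ENNReal.ofReal (Metric.diam Γ ^ (2 * σ)) *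
        ∑ T ∈ 𝒯, scaleWeight σ T * ∫⁻ x in T, ‖u x‖ₑ ^ 2 ∂μHE[d - 1] := by
  rw [eLpNorm_two_sq, Finset.mul_sum]
  calc _ = ∫⁻ x in ⋃ T ∈ 𝒯, T, ‖u x‖ₑ ^ 2 ∂μHE[d - 1] := by rw [← h𝒯.cover]
    _ ≤ _ := lintegral_biUnion_finset_le _ 𝒯 (fun T => T) _
    _ ≤ _ := by
        refine Finset.sum_le_sum fun T hT => ?_
        have hTΓ : T ⊆ Γ := by
          rw [h𝒯.cover]
          exact Set.subset_biUnion_of_mem (u := fun T => T) hT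
        have hdT := hdiam T hT
        have hle := Metric.diam_mono hTΓ hΓ
        rw [← mul_assoc, scaleWeight, ← ENNReal.ofReal_mul (by positivity)]
        refine le_mul_of_one_le_left' ?_
        rw [ENNReal.one_le_ofReal, Real.rpow_neg hdT.le, ← div_eq_mul_inv,
          one_le_div (by positivity)]
        gcongr

end BEM

open BEM
theorem proposition4p2 (d : ℕ) (hd : 2 ≤ d) (σ : ℝ) (hσ₀ : 0 < σ) (hσ₁ : σ < 1)
    (Γ : Set (Euc d))
    (hΓ : ∃ Ω : Set (Euc d), IsLipschitzDomain Ω ∧ Bornology.IsBounded Ω ∧ Γ = frontier Ω)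
    (Cpatch Clocuni Cshape Ccent : ℝ) (hpatch : 0 < Cpatch) (hlocuni : 0 < Clocuni)
    (hshape : 0 < Cshape) (hcent : 0 < Ccent)
    (qsupp : ℕ) (ρ : ℝ) (hρ₀ : 0 < ρ) (hρ₁ : ρ < 1) :
    ∃ Csplit : ℝ, 0 < Csplit ∧
      ∀ 𝒯 : Finset (Set (Euc d)), IsMesh Γ 𝒯 →
        BoundedPatch 𝒯 Cpatch → LocallyQuasiUniform 𝒯 Clocuni →
        ShapeRegular 𝒯 Cshape → CenteredInPatch Γ 𝒯 Ccent →
      ∀ (D : ℕ) (X : Submodule ℂ (L2 Γ D)), FiniteDimensional ℂ X →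
      ∀ Ψ : Set (Euc d) → Fin D → L2 Γ D, IsLocalUnity Γ 𝒯 X qsupp ρ Ψ →
      ∀ v : L2 Γ D, MemSobolev Γ σ v →
        (∀ T ∈ 𝒯, ∀ j, inner ℂ v (Ψ T j) = 0) →
        vecNormSq σ Γ v ≤ ENNReal.ofReal Csplit *
          ∑ T ∈ 𝒯, ∑ T' ∈ patchElements 𝒯 1 T, vecSeminormSq σ (T ∪ T') v := by
  obtain ⟨Ω, hΩ, -, rfl⟩ := hΓ
  obtain ⟨A, hA⟩ := hΩ.measure_frontier_inter_closedBall_le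
  have hbdd := hΩ.isCompact_frontier.isBounded
  have hfin : (μHE[d - 1] : Measure (Euc d)) (frontier Ω) ≠ ∞ := by
    obtain ⟨r, hr, hsub⟩ := hbdd.subset_closedBall_lt 0 0
    have := hA 0 r hr.le
    rw [Set.inter_eq_left.2 hsub] at this
    exact ne_top_of_le_ne_top (by finiteness) this
  let P : ℝ≥0 := Cpatch.toNNReal
  let K : ℝ≥0 := (Cshape ^ (d - 1)).toNNReal
  obtain ⟨W, hW⟩ := exists_sum_scaleWeight_mul_lintegral_le hd hσ₀ hfin P K hlocuni qsupp
    hρ₀.le hρ₁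
  obtain ⟨C, hC⟩ := exists_seminormSq_le hd hσ₀ hA P K Clocuni hcent
  let M : ℝ≥0 := (Metric.diam (frontier Ω) ^ (2 * σ)).toNNReal
  refine ⟨((M * W + (1 + C * W) : ℝ≥0) : ℝ), by positivity,
    fun 𝒯 h𝒯 hp hl hs hc D X _ Ψ hΨ v _ hv => ?_⟩
  have hreg := h𝒯.regularMesh hd hshape hp hl hs
  have hsum : ∑ T ∈ 𝒯, ∑ T' ∈ patchElements 𝒯 1 T, vecSeminormSq σ (T ∪ T') v =
      ∑ j, ∑ T ∈ 𝒯, patchSeminormSq σ 𝒯 (fun x => v x j) T := by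
    simp only [vecSeminormSq, patchSeminormSq]
    rw [Finset.sum_comm]
    exact Finset.sum_congr rfl fun T _ => Finset.sum_comm
  rw [hsum, vecNormSq, Finset.mul_sum, ENNReal.ofReal_coe_nnreal]
  refine Finset.sum_le_sum fun j _ => ?_
  have hu : Measurable fun x => v x j := by
    have := (Lp.stronglyMeasurable v).measurable
    fun_prop
  have hWj := hW 𝒯 h𝒯 hreg D X Ψ hΨ v j fun T hT => hv T hT j
  calc _ ≤ M * (W * ∑ T ∈ 𝒯, patchSeminormSq σ 𝒯 (fun x => v x j) T) +
        (∑ T ∈ 𝒯, patchSeminormSq σ 𝒯 (fun x => v x j) T +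
          C * (W * ∑ T ∈ 𝒯, patchSeminormSq σ 𝒯 (fun x => v x j) T)) := by
        refine add_le_add ?_ ?_
        · exact (eLpNorm_sq_le_sum_scaleWeight hσ₀ hbdd h𝒯 hreg.diam_pos _).trans
            (mul_le_mul_right hWj _)
        · exact (hC 𝒯 h𝒯 hreg hc _ hu).trans (add_le_add_right (mul_le_mul_right hWj _) _)
    _ = _ := by push_cast; ring
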